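/- Let $n,r\ge 0$ be integers. Let $\Lambda(n,r)$ be the set of sequences $\lambda=(\lambda_1,\dots,\lambda_n)$ of nonnegative integers with sum $r$, and let $\Lambda^{\bullet}(n,r)\subseteq\Lambda(n,r)$ consist of those $\lambda$ for which $\lambda_i=0$ implies $\lambda_j=0$ for all $j>i$. Let $M_n(r)$ be the set of $n\times n$ matrices with nonnegative integer entries of total sum $r$; for $A\in M_n(r)$ write $\mathrm{ro}(A),\mathrm{co}(A)\in\Lambda(n,r)$ for its vectors of row sums and column sums. *The algebra.* For $A\in M_n(r)$ and $0\le i,k\le n$ put $\mathrm{ne}_A(i,k)=\sum_{a\le i,\ b>k}A_{a,b}$. Let $\mathbf S_0(n,r)$ be the $0$-Schur algebra over $\mathbb C$, in its realization by relative positions of pairs of $n$-step flags in an $r$-dimensional space: it has the standard basis $\{e_A\mid A\in M_n(r)\}$, with $e_Ae_B=0$ if $\mathrm{co}(A)\ne\mathrm{ro}(B)$, and $e_Ae_B=e_C$ if $\mathrm{co}(A)=\mathrm{ro}(B)$, where $C\in M_n(r)$ is the generic composite of $A$ and $B$, that is, the unique matrix with $\mathrm{ne}_C(i,k)=\min_{0\le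 j\le n}\bigl(\mathrm{ne}_A(i,j)+\mathrm{ne}_B(j,k)\bigr)$ for all $i,k$. The identity is $\sum_{\lambda\in\Lambda(n,r)}k_\lambda$ with $k_\lambda=e_{\mathrm{diag}(\lambda)}$. *The modules $P_\lambda$.* A matrix is *open* if every $2\times 2$ submatrix of it has at least one zero on its diagonal. Let $\alpha$ be a composition of $n$ into positive parts; it cuts $\{1,\dots,n\}$ into consecutive blocks. A matrix $A\in M_n(r)$ is *open on columns with respect to $\alpha$* if, for each block, the matrix obtained from $A$ by replacing all columns outside the block by zero is open. For $\lambda\in\Lambda(n,r)$, $\alpha$ is *maximal with respect to $\lambda$* if each of the subsequences into which $\alpha$ cuts $\lambda$ either equals $(0)$ or has nonzero first and last entries. Let $B^\lambda$ be the set of all $e_A$ such that $\mathrm{co}(A)=\lambda$ and $A$ is not open on columns with respect to any $\alpha\neq(1,\dots,1)$ that is maximal with respect to $\lambda$. Let $P_\lambda$ be the $\mathbf S_0(n,r)$-module with $\mathbb C$-basis $B^\lambda$ in which $e_C\cdot e_A$ is the product $e_Ce_A$ if this product lies in $B^\lambda$, and $0$ otherwise. *The submodule $N_\lambda$.* A matrix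 $A$ is *column block diagonal* if $A_{i,j}>0$ implies $A_{i',j'}=0$ for all $i'\le i$ and $j'>j$. Let $\beta^\lambda$ be the set of all $e_A$ with $A$ column block diagonal and $\mathrm{co}(A)=\lambda$. Let $N_\lambda$ be the $\mathbb C$-span of $B^\lambda\setminus\beta^\lambda$, which is a submodule of $P_\lambda$, and let $S_\lambda=P_\lambda/N_\lambda$. For a module $M$ let $\mathrm{rad}(M)$ be the intersection of its maximal submodules and $\mathrm{top}(M)=M/\mathrm{rad}(M)$. **Claim.** For every $\lambda\in\Lambda^{\bullet}(n,r)$ one has $N_\lambda=\mathrm{rad}(P_\lambda)$. Equivalently, $S_\lambda=\mathrm{top}(P_\lambda)$: there is an isomorphism of $\mathbf S_0(n,r)$-modules $S_\lambda\to\mathrm{top}(P_\lambda)$ that sends $x+N_\lambda$ to $x+\mathrm{rad}(P_\lambda)$ for every $x\in P_\lambda$. -/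

import Mathlib

namespace SchurZero

/-! ### Weak compositions and nonnegative integer matrices -/

/-- Weak compositions of `r` of length `n`. -/
def WeakComp (n r : ℕ) : Type := {l : Fin n → ℕ // ∑ i, l i = r}

instance (n r : ℕ) : Fintype (WeakComp n r) :=
  Fintype.subtype (Finset.Nat.antidiagonalTuple n r)
    (fun _ => Finset.Nat.mem_antidiagonalTuple)

instance (n r : ℕ) : DecidableEq (WeakComp n r) :=
  inferInstanceAs (DecidableEq {l : Fin n → ℕ // ∑ i, l i = r})

/-- `l i = 0` implies `l j = 0` for all `j > i`. -/
def WeakComp.IsBullet {n r : ℕ} (l : WeakComp n r) : Prop :=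
  ∀ i, l.1 i = 0 → ∀ j, i < j → l.1 j = 0

/-- `n × n` matrices of nonnegative integers with total sum of entries `r`. -/
def Mat (n r : ℕ) : Type := {A : Matrix (Fin n) (Fin n) ℕ // ∑ i, ∑ j, A i j = r}

/-- The row-sum vector. -/
def ro {n r : ℕ} (A : Mat n r) : WeakComp n r := ⟨fun i => ∑ j, A.1 i j, A.2⟩

/-- The column-sum vector. -/
def co {n r : ℕ} (A : Mat n r) : WeakComp n r :=
  ⟨fun j => ∑ i, A.1 i j, by rw [Finset.sum_comm]; exact A.2⟩

/-- The diagonal matrix with diagonal `l`. -/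
def diagMat {n r : ℕ} (l : WeakComp n r) : Mat n r :=
  ⟨Matrix.diagonal l.1, by
    have : ∀ i : Fin n, ∑ j, Matrix.diagonal l.1 i j = l.1 i := fun i => by
      simp [Matrix.diagonal_apply]
    simp only [this]; exact l.2⟩

/-! ### The product of two matrices: generic composition of relative positions -/

/-- The north-east corner sum: the sum of the entries in the first `i` rows that do not lie in the
first `k` columns. If two `n`-step flags `f`, `h` of an `r`-dimensional space are in relative
position `A`, this is the dimension of `f_i / (f_i ∩ h_k)`. -/
def ne {n : ℕ} (A : Matrix (Fin n) (Fin n) ℕ) (i k : ℕ) : ℕ :=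
  ∑ a : Fin n, ∑ b : Fin n, if (a : ℕ) < i ∧ k ≤ (b : ℕ) then A a b else 0

/-- `min_{0 ≤ j ≤ n} (ne A i j + ne B j k)`. For flags `f`, `g`, `h` with `(f, g)` in relative
position `A` and `(g, h)` in relative position `B`, this is the largest (that is, the generic)
value of `dim f_i / (f_i ∩ h_k)`. -/
def minPlus {n : ℕ} (A B : Matrix (Fin n) (Fin n) ℕ) (i k : ℕ) : ℕ :=
  (Finset.range (n + 1)).inf' ⟨0, by simp⟩ (fun j => ne A i j + ne B j k)

/-- The matrix whose north-east corner sums are `minPlus A B`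
(for `A`, `B` such that the column sums of `A` are the row sums of `B`). -/
def prodMat {n : ℕ} (A B : Matrix (Fin n) (Fin n) ℕ) : Matrix (Fin n) (Fin n) ℕ :=
  fun a b => minPlus A B (a + 1) b + minPlus A B a (b + 1)
    - (minPlus A B a b + minPlus A B (a + 1) (b + 1))

/-- Sum over the rectangle of rows `i ≤ a < i'` and columns `k ≤ b < k'`. -/
def rect {n : ℕ} (A : Matrix (Fin n) (Fin n) ℕ) (i i' k k' : ℕ) : ℕ :=
  ∑ a : Fin n, ∑ b : Fin n,
    if i ≤ (a : ℕ) ∧ (a : ℕ) < i' ∧ k ≤ (b : ℕ) ∧ (b : ℕ) < k' then A a b else 0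

theorem rect_add_ne {n : ℕ} (A : Matrix (Fin n) (Fin n) ℕ) {i i' k k' : ℕ}
    (hi : i ≤ i') (hk : k ≤ k') :
    rect A i i' k k' + (ne A i k + ne A i' k') = ne A i' k + ne A i k' := by
  simp only [rect, ne, ← Finset.sum_add_distrib]
  refine Finset.sum_congr rfl fun a _ => Finset.sum_congr rfl fun b _ => ?_
  split_ifs <;> omega

theorem rect_eq_zero {n : ℕ} (A : Matrix (Fin n) (Fin n) ℕ) {i i' k k' : ℕ} :
    rect A i i' k k' = 0 ↔ ∀ a b : Fin n, i ≤ (a : ℕ) → (a : ℕ) < i' → k ≤ (b : ℕ) →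
      (b : ℕ) < k' → A a b = 0 := by
  simp only [rect, Finset.sum_eq_zero_iff, Finset.mem_univ, true_implies, ite_eq_right_iff,
    and_imp]

theorem rect_single {n : ℕ} (A : Matrix (Fin n) (Fin n) ℕ) (a b : Fin n) :
    rect A a (a + 1) b (b + 1) = A a b := by
  unfold rect
  rw [Finset.sum_eq_single a, Finset.sum_eq_single b]
  · simp
  · intro b' _ hb
    rw [if_neg]; intro h; exact hb (Fin.ext (by omega))
  · simp
  · intro a' _ ha
    refine Finset.sum_eq_zero fun b' _ => if_neg ?_
    intro h; exact ha (Fin.ext (by omega))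
  · simp

theorem ne_zero_left {n : ℕ} (A : Matrix (Fin n) (Fin n) ℕ) (k : ℕ) : ne A 0 k = 0 := by
  simp [ne]

theorem ne_last {n : ℕ} (A : Matrix (Fin n) (Fin n) ℕ) (i : ℕ) : ne A i n = 0 := by
  simp only [ne, Finset.sum_eq_zero_iff, Finset.mem_univ, true_implies, ite_eq_right_iff]
  intro a b h; have := b.2; omega

theorem ne_entry {n : ℕ} (A : Matrix (Fin n) (Fin n) ℕ) (a b : Fin n) :
    A a b + (ne A a b + ne A (a + 1) (b + 1)) = ne A (a + 1) b + ne A a (b + 1) := by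
  rw [← rect_single A a b]; exact rect_add_ne A (by omega) (by omega)

theorem ne_monge {n : ℕ} (A : Matrix (Fin n) (Fin n) ℕ) {i i' k k' : ℕ}
    (hi : i ≤ i') (hk : k ≤ k') : ne A i k + ne A i' k' ≤ ne A i' k + ne A i k' := by
  have := rect_add_ne A hi hk; omega

theorem ne_row {n r : ℕ} (A : Mat n r) (a : Fin n) :
    ne A.1 (a + 1) 0 = ne A.1 a 0 + (ro A).1 a := by
  have h := rect_add_ne A.1 (Nat.le_succ (a : ℕ)) (Nat.zero_le n)
  have h2 : rect A.1 a (a + 1) 0 n = (ro A).1 a := by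
    unfold rect
    rw [Finset.sum_eq_single a]
    · simp [ro]
    · intro a' _ ha
      refine Finset.sum_eq_zero fun b' _ => if_neg ?_
      intro h; exact ha (Fin.ext (by omega))
    · simp
  simp only [ne_last, Nat.succ_eq_add_one] at h
  omega

theorem ne_col {n r : ℕ} (A : Mat n r) (b : Fin n) :
    ne A.1 n b = (co A).1 b + ne A.1 n (b + 1) := by
  have h := rect_add_ne A.1 (Nat.zero_le n) (Nat.le_succ (b : ℕ))
  have h2 : rect A.1 0 n b (b + 1) = (co A).1 b := by
    unfold rect co
    refine Finset.sum_congr rfl fun a _ => ?_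
    rw [Finset.sum_eq_single b]
    · simp
    · intro b' _ hb
      rw [if_neg]; intro h; exact hb (Fin.ext (by omega))
    · simp
  simp only [ne_zero_left, Nat.succ_eq_add_one] at h
  omega

theorem ne_full {n : ℕ} (A : Matrix (Fin n) (Fin n) ℕ) : ne A n 0 = ∑ i, ∑ j, A i j := by
  simp [ne]

theorem ne_full' {n r : ℕ} (A : Mat n r) : ne A.1 n 0 = r := by rw [ne_full]; exact A.2

/-- A matrix is determined by its corner sums. -/
theorem ne_inj {n : ℕ} {A B : Matrix (Fin n) (Fin n) ℕ}
    (h : ∀ i k, i ≤ n → k ≤ n → ne A i k = ne B i k) : A = B := by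
  ext a b
  have h1 := ne_entry A a b
  have h2 := ne_entry B a b
  rw [h _ _ (by omega) (by omega), h _ _ (by omega) (by omega), h _ _ (by omega) (by omega),
    h _ _ (by omega) (by omega)] at h1
  omega

theorem ne_compl {n r : ℕ} {A B : Mat n r} (h : co A = ro B) {j : ℕ} (hj : j ≤ n) :
    ne A.1 n j + ne B.1 j 0 = r := by
  induction j with
  | zero => rw [ne_full', ne_zero_left]; rfl
  | succ j ih =>
    have h1 := ne_col A ⟨j, hj⟩
    have h2 := ne_row B ⟨j, hj⟩
    rw [h] at h1
    have := ih (by omega)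
    simp only at h1 h2
    omega

/-- The matrix with prescribed corner sums. -/
theorem ne_of_monge {n : ℕ} (m : ℕ → ℕ → ℕ) (C : Matrix (Fin n) (Fin n) ℕ)
    (h0 : ∀ k, k ≤ n → m 0 k = 0) (hn : ∀ i, i ≤ n → m i n = 0)
    (hC : ∀ a b : Fin n, C a b + (m a b + m (a + 1) (b + 1)) = m (a + 1) b + m a (b + 1)) :
    ∀ i k, i ≤ n → k ≤ n → ne C i k = m i k := by
  intro i
  induction i with
  | zero => intro k _ hk; rw [ne_zero_left, h0 k hk]
  | succ i ih =>
    intro k hi hk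
    refine Nat.decreasingInduction (motive := fun k _ => ne C (i + 1) k = m (i + 1) k)
      (fun k hk ihk => ?_) ?_ hk
    · have h1 := ne_entry C ⟨i, hi⟩ ⟨k, hk⟩
      have h2 := hC ⟨i, hi⟩ ⟨k, hk⟩
      have h3 := ih k (by omega) hk.le
      have h4 := ih (k + 1) (by omega) hk
      simp only at h1 h2
      omega
    · rw [ne_last, hn _ hi]

theorem minPlus_le {n : ℕ} (A B : Matrix (Fin n) (Fin n) ℕ) (i k : ℕ) {j : ℕ} (hj : j ≤ n) :
    minPlus A B i k ≤ ne A i j + ne B j k :=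
  Finset.inf'_le (fun j => ne A i j + ne B j k) (Finset.mem_range.2 (Nat.lt_succ_of_le hj))

theorem minPlus_exists {n : ℕ} (A B : Matrix (Fin n) (Fin n) ℕ) (i k : ℕ) :
    ∃ j, j ≤ n ∧ minPlus A B i k = ne A i j + ne B j k := by
  obtain ⟨j, hj, h⟩ := Finset.exists_mem_eq_inf' (s := Finset.range (n + 1)) ⟨0, by simp⟩
    (fun j => ne A i j + ne B j k)
  exact ⟨j, Nat.lt_succ_iff.1 (Finset.mem_range.1 hj), h⟩

theorem minPlus_monge {n : ℕ} (A B : Matrix (Fin n) (Fin n) ℕ) (i k : ℕ) :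
    minPlus A B i k + minPlus A B (i + 1) (k + 1)
      ≤ minPlus A B (i + 1) k + minPlus A B i (k + 1) := by
  obtain ⟨j, hj, h1⟩ := minPlus_exists A B (i + 1) k
  obtain ⟨l, hl, h2⟩ := minPlus_exists A B i (k + 1)
  have a1 := minPlus_le A B i k hj
  have a2 := minPlus_le A B i k hl
  have a3 := minPlus_le A B (i + 1) (k + 1) hj
  have a4 := minPlus_le A B (i + 1) (k + 1) hl
  rcases le_total j l with h | h
  · have := ne_monge A (Nat.le_succ i) h
    simp only [Nat.succ_eq_add_one] at this
    omega
  · have := ne_monge B h (Nat.le_succ k)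
    simp only [Nat.succ_eq_add_one] at this
    omega

theorem ne_prodMat {n : ℕ} (A B : Matrix (Fin n) (Fin n) ℕ) :
    ∀ i k, i ≤ n → k ≤ n → ne (prodMat A B) i k = minPlus A B i k := by
  refine ne_of_monge _ _ (fun k _ => ?_) (fun i _ => ?_) (fun a b => ?_)
  · have := minPlus_le A B 0 k (Nat.zero_le n)
    simpa [ne_zero_left] using this
  · have := minPlus_le A B i n le_rfl
    simpa [ne_last] using this
  · have := minPlus_monge A B a b
    simp only [prodMat]
    omega

/-- The generic product of two matrices `A`, `B` with `co A = ro B`. -/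
def prod {n r : ℕ} (A B : Mat n r) (h : co A = ro B) : Mat n r :=
  ⟨prodMat A.1 B.1, by
    rw [← ne_full, ne_prodMat _ _ _ _ le_rfl (Nat.zero_le n)]
    refine le_antisymm ?_ ?_
    · have := minPlus_le A.1 B.1 n 0 (Nat.zero_le n)
      rwa [ne_full', ne_zero_left] at this
    · obtain ⟨j, hj, h1⟩ := minPlus_exists A.1 B.1 n 0
      rw [h1, ne_compl h hj]⟩

theorem ne_prod_le {n r : ℕ} {A B : Mat n r} (h : co A = ro B) {i j k : ℕ} (hi : i ≤ n)
    (hj : j ≤ n) (hk : k ≤ n) : ne (prod A B h).1 i k ≤ ne A.1 i j + ne B.1 j k := by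
  change ne (prodMat _ _) _ _ ≤ _
  rw [ne_prodMat _ _ _ _ hi hk]; exact minPlus_le _ _ _ _ hj

theorem ne_prod_exists {n r : ℕ} {A B : Mat n r} (h : co A = ro B) {i k : ℕ} (hi : i ≤ n)
    (hk : k ≤ n) : ∃ j, j ≤ n ∧ ne (prod A B h).1 i k = ne A.1 i j + ne B.1 j k := by
  change ∃ j, j ≤ n ∧ ne (prodMat _ _) _ _ = _
  rw [ne_prodMat _ _ _ _ hi hk]; exact minPlus_exists _ _ _ _

theorem prod_unique {n r : ℕ} {A B C : Mat n r} (h : co A = ro B)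
    (h1 : ∀ i j k, i ≤ n → j ≤ n → k ≤ n → ne C.1 i k ≤ ne A.1 i j + ne B.1 j k)
    (h2 : ∀ i k, i ≤ n → k ≤ n → ∃ j, j ≤ n ∧ ne A.1 i j + ne B.1 j k ≤ ne C.1 i k) :
    prod A B h = C := by
  refine Subtype.ext (ne_inj fun i k hi hk => le_antisymm ?_ ?_)
  · obtain ⟨j, hj, hh⟩ := h2 i k hi hk
    exact (ne_prod_le h hi hj hk).trans hh
  · obtain ⟨j, hj, hh⟩ := ne_prod_exists h hi hk
    rw [hh]; exact h1 i j k hi hj hk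

theorem ne_prod_row {n r : ℕ} {A B : Mat n r} (h : co A = ro B) {i : ℕ} (hi : i ≤ n) :
    ne (prod A B h).1 i 0 = ne A.1 i 0 := by
  refine le_antisymm ?_ ?_
  · have := ne_prod_le h hi (Nat.zero_le n) (Nat.zero_le n)
    rwa [ne_zero_left, add_zero] at this
  · obtain ⟨j, hj, hh⟩ := ne_prod_exists h hi (Nat.zero_le n)
    have h1 := ne_compl h hj
    have h2 := ne_monge A.1 hi (Nat.zero_le j)
    have h3 := ne_full' A
    omega

theorem ne_prod_col {n r : ℕ} {A B : Mat n r} (h : co A = ro B) {k : ℕ} (hk : k ≤ n) :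
    ne (prod A B h).1 n k = ne B.1 n k := by
  refine le_antisymm ?_ ?_
  · have := ne_prod_le h le_rfl le_rfl hk
    rwa [ne_last, zero_add] at this
  · obtain ⟨j, hj, hh⟩ := ne_prod_exists h le_rfl hk
    have h1 := ne_compl h hj
    have h2 := ne_monge B.1 hj (Nat.zero_le k)
    have h3 := ne_full' B
    omega

theorem ro_prod {n r : ℕ} {A B : Mat n r} (h : co A = ro B) : ro (prod A B h) = ro A := by
  refine Subtype.ext (funext fun a => ?_)
  have h1 := ne_row (prod A B h) a
  have h2 := ne_row A a
  rw [ne_prod_row h (by omega), ne_prod_row h (by omega)] at h1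
  omega

theorem co_prod {n r : ℕ} {A B : Mat n r} (h : co A = ro B) : co (prod A B h) = co B := by
  refine Subtype.ext (funext fun b => ?_)
  have h1 := ne_col (prod A B h) b
  have h2 := ne_col B b
  rw [ne_prod_col h (by omega), ne_prod_col h (by omega)] at h1
  omega

theorem prod_assoc {n r : ℕ} {A B C : Mat n r} (h : co A = ro B) (h' : co B = ro C)
    (h1 : co (prod A B h) = ro C) (h2 : co A = ro (prod B C h')) :
    prod (prod A B h) C h1 = prod A (prod B C h') h2 := by
  refine prod_unique _ (fun i j k hi hj hk => ?_) (fun i k hi hk => ?_)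
  · obtain ⟨l, hl, e1⟩ := ne_prod_exists h hi hj
    have e2 := ne_prod_le h2 hi hl hk
    have e3 := ne_prod_le h' hl hj hk
    omega
  · obtain ⟨l, hl, e1⟩ := ne_prod_exists h2 hi hk
    obtain ⟨j, hj, e2⟩ := ne_prod_exists h' hl hk
    have e3 := ne_prod_le h hi hl hj
    exact ⟨j, hj, by omega⟩

theorem ne_diag_upper {n r : ℕ} (l : WeakComp n r) {i j : ℕ} (hij : i ≤ j) :
    ne (diagMat l).1 i j = 0 := by
  simp only [ne, Finset.sum_eq_zero_iff, Finset.mem_univ, true_implies, ite_eq_right_iff]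
  intro a b h
  exact Matrix.diagonal_apply_ne _ (fun hab => by subst hab; omega)

theorem ne_diag_lower {n r : ℕ} (l : WeakComp n r) {i j : ℕ} (hij : j ≤ i) :
    ne (diagMat l).1 i j + ne (diagMat l).1 j 0 = ne (diagMat l).1 i 0 := by
  have h := rect_add_ne (diagMat l).1 hij (Nat.zero_le j)
  have h0 : rect (diagMat l).1 j i 0 j = 0 := by
    rw [rect_eq_zero]
    intro a b h1 _ _ h4
    exact Matrix.diagonal_apply_ne _ (fun hab => by subst hab; omega)
  have := ne_diag_upper l (le_refl j)
  omega

theorem ro_diag {n r : ℕ} (l : WeakComp n r) : ro (diagMat l) = l := by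
  refine Subtype.ext (funext fun i => ?_)
  simp [ro, diagMat, Matrix.diagonal_apply]

theorem co_diag {n r : ℕ} (l : WeakComp n r) : co (diagMat l) = l := by
  refine Subtype.ext (funext fun i => ?_)
  simp [co, diagMat, Matrix.diagonal_apply]

theorem ne_row_congr {n r : ℕ} {A B : Mat n r} (h : ro A = ro B) {i : ℕ} (hi : i ≤ n) :
    ne A.1 i 0 = ne B.1 i 0 := by
  induction i with
  | zero => simp [ne_zero_left]
  | succ i ih =>
    have h1 := ne_row A ⟨i, hi⟩
    have h2 := ne_row B ⟨i, hi⟩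
    rw [h] at h1
    have := ih (by omega)
    simp only at h1 h2
    omega

theorem prod_diag_left {n r : ℕ} {A : Mat n r} {l : WeakComp n r} (h : co (diagMat l) = ro A) :
    prod (diagMat l) A h = A := by
  have hl : ro (diagMat l) = ro A := by rw [ro_diag, ← h, co_diag]
  refine prod_unique _ (fun i j k hi hj hk => ?_) (fun i k hi hk => ⟨i, hi, ?_⟩)
  · rcases le_total i j with hij | hij
    · have h1 := ne_monge A.1 hij hk
      rw [ne_last, ne_last] at h1
      omega
    · have h1 := ne_diag_lower l hij
      rw [ne_row_congr hl hi, ne_row_congr hl hj] at h1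
      have h2 := ne_monge A.1 hij (Nat.zero_le k)
      omega
  · rw [ne_diag_upper l le_rfl, zero_add]

theorem prod_diag_right {n r : ℕ} {A : Mat n r} {l : WeakComp n r} (h : co A = ro (diagMat l)) :
    prod A (diagMat l) h = A := by
  refine prod_unique _ (fun i j k hi hj hk => ?_) (fun i k hi hk => ⟨k, hk, ?_⟩)
  · rcases le_total j k with hjk | hjk
    · have h1 := ne_monge A.1 (Nat.zero_le i) hjk
      rw [ne_zero_left, ne_zero_left] at h1
      omega
    · have h1 := ne_diag_lower l hjk
      have h2 := ne_monge A.1 hi hjk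
      have h3 := ne_compl h hj
      have h4 := ne_compl h hk
      omega
  · rw [ne_diag_upper l le_rfl, add_zero]

/-! ### The 0-Schur algebra over `ℂ` -/

/-- The 0-Schur algebra over `ℂ`, in its realization by relative positions of pairs of `n`-step
flags in an `r`-dimensional space: it has the standard basis `e_A`, where `A` runs over the
`n × n` matrices of nonnegative integers with sum `r` (the orbits of pairs of flags), and
`e_A e_B = e_C` with `C` the generic composite of `A` and `B` if `co A = ro B`, and `e_A e_B = 0`
otherwise. The facts `k_mul_e`, `e_mul_k`, `eGen_mul`, `fGen_mul` below are the usual rules for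
the products `k_l e_A`, `e_A k_l`, `e_i e_A` and `f_i e_A`; as the `k_l`, `e_i`, `f_i` generate the
algebra (`adjoin_generators`), these rules determine the multiplication of the standard basis. -/
def Alg (n r : ℕ) : Type := Mat n r →₀ ℂ

noncomputable section

instance (n r : ℕ) : AddCommGroup (Alg n r) := inferInstanceAs (AddCommGroup (Mat n r →₀ ℂ))

instance (n r : ℕ) : Module ℂ (Alg n r) := inferInstanceAs (Module ℂ (Mat n r →₀ ℂ))

/-- The standard basis element `e_A`. -/
def e {n r : ℕ} (A : Mat n r) : Alg n r := Finsupp.single A 1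

/-- The idempotent `k_l = e_{diag l}`. -/
def k {n r : ℕ} (l : WeakComp n r) : Alg n r := e (diagMat l)

/-- The product of two standard basis elements: `e_A e_B = e_C` with `C` the generic product if
`co A = ro B`, and `0` otherwise. -/
def basisMul {n r : ℕ} (A B : Mat n r) : Alg n r :=
  if h : co A = ro B then e (prod A B h) else 0

/-- The bilinear extension of `basisMul`. -/
def mulLin (n r : ℕ) : Alg n r →ₗ[ℂ] Alg n r →ₗ[ℂ] Alg n r :=
  Finsupp.linearCombination ℂ fun A : Mat n r =>
    (Finsupp.linearCombination ℂ fun B : Mat n r => basisMul A B : (Mat n r →₀ ℂ) →ₗ[ℂ] Alg n r)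

instance (n r : ℕ) : Mul (Alg n r) := ⟨fun x y => mulLin n r x y⟩

instance (n r : ℕ) : One (Alg n r) := ⟨∑ l : WeakComp n r, k l⟩

theorem mul_def {n r : ℕ} (x y : Alg n r) : x * y = mulLin n r x y := rfl

theorem one_def (n r : ℕ) : (1 : Alg n r) = ∑ l : WeakComp n r, k l := rfl

theorem e_mul_e {n r : ℕ} (A B : Mat n r) :
    e A * e B = if h : co A = ro B then e (prod A B h) else 0 := by
  have h1 : mulLin n r (e A) = (Finsupp.linearCombination ℂ fun B : Mat n r => basisMul A B :
      (Mat n r →₀ ℂ) →ₗ[ℂ] Alg n r) := by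
    refine (Finsupp.linearCombination_single ℂ (1 : ℂ) A).trans (one_smul _ _)
  rw [mul_def, h1]
  exact (Finsupp.linearCombination_single ℂ (1 : ℂ) B).trans (one_smul _ _)

theorem alg_induction {n r : ℕ} {p : Alg n r → Prop} (x : Alg n r) (h0 : p 0)
    (hadd : ∀ x y, p x → p y → p (x + y)) (hs : ∀ (c : ℂ) (A : Mat n r), p (c • e A)) : p x := by
  refine Finsupp.induction_linear (motive := p) x h0 hadd fun A c => ?_
  have : (Finsupp.single A c : Mat n r →₀ ℂ) = c • Finsupp.single A 1 := by simp
  rw [this]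
  exact hs c A

theorem mul_add' {n r : ℕ} (x y z : Alg n r) : x * (y + z) = x * y + x * z :=
  map_add (mulLin n r x) y z

theorem add_mul' {n r : ℕ} (x y z : Alg n r) : (x + y) * z = x * z + y * z := by
  simp only [mul_def, map_add, LinearMap.add_apply]

theorem smul_mul' {n r : ℕ} (c : ℂ) (x y : Alg n r) : (c • x) * y = c • (x * y) := by
  simp only [mul_def, map_smul, LinearMap.smul_apply]

theorem mul_smul' {n r : ℕ} (c : ℂ) (x y : Alg n r) : x * (c • y) = c • (x * y) :=
  map_smul (mulLin n r x) c y

theorem zero_mul' {n r : ℕ} (x : Alg n r) : 0 * x = 0 := by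
  simp only [mul_def, map_zero, LinearMap.zero_apply]

theorem mul_zero' {n r : ℕ} (x : Alg n r) : x * 0 = 0 := map_zero (mulLin n r x)

theorem e_mul_assoc {n r : ℕ} (A B C : Mat n r) : e A * e B * e C = e A * (e B * e C) := by
  by_cases h : co A = ro B
  · by_cases h' : co B = ro C
    · have h1 : co (prod A B h) = ro C := by rw [co_prod, h']
      have h2 : co A = ro (prod B C h') := by rw [ro_prod, h]
      rw [e_mul_e A B, dif_pos h, e_mul_e B C, dif_pos h', e_mul_e, dif_pos h1, e_mul_e,
        dif_pos h2, prod_assoc]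
    · have h1 : ¬ co (prod A B h) = ro C := by rwa [co_prod]
      rw [e_mul_e A B, dif_pos h, e_mul_e B C, dif_neg h', e_mul_e, dif_neg h1, mul_zero']
  · rw [e_mul_e A B, dif_neg h, zero_mul']
    by_cases h' : co B = ro C
    · have h2 : ¬ co A = ro (prod B C h') := by rwa [ro_prod]
      rw [e_mul_e B C, dif_pos h', e_mul_e, dif_neg h2]
    · rw [e_mul_e B C, dif_neg h', mul_zero']

theorem mul_assoc' {n r : ℕ} (x y z : Alg n r) : x * y * z = x * (y * z) := by
  refine alg_induction (p := fun x => x * y * z = x * (y * z)) x ?_ ?_ ?_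
  · simp only [zero_mul']
  · intro x x' h h'; simp only [add_mul', h, h']
  intro c A
  refine alg_induction (p := fun y => c • e A * y * z = c • e A * (y * z)) y ?_ ?_ ?_
  · simp only [zero_mul', mul_zero']
  · intro x x' h h'; simp only [add_mul', mul_add', h, h']
  intro d B
  refine alg_induction (p := fun z => c • e A * (d • e B) * z = c • e A * (d • e B * z)) z ?_ ?_ ?_
  · simp only [mul_zero']
  · intro x x' h h'; simp only [mul_add', h, h']
  intro f C
  simp only [smul_mul', mul_smul', e_mul_assoc]

theorem k_mul_e {n r : ℕ} (l : WeakComp n r) (A : Mat n r) :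
    k l * e A = if l = ro A then e A else 0 := by
  rw [k, e_mul_e]
  by_cases h : l = ro A
  · have h' : co (diagMat l) = ro A := by rw [co_diag, h]
    rw [dif_pos h', if_pos h, prod_diag_left]
  · rw [dif_neg (by rwa [co_diag]), if_neg h]

theorem e_mul_k {n r : ℕ} (l : WeakComp n r) (A : Mat n r) :
    e A * k l = if l = co A then e A else 0 := by
  rw [k, e_mul_e]
  by_cases h : l = co A
  · have h' : co A = ro (diagMat l) := by rw [ro_diag, h]
    rw [dif_pos h', if_pos h, prod_diag_right]
  · rw [dif_neg (by rw [ro_diag]; exact fun h' => h h'.symm), if_neg h]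

theorem sum_mul' {n r : ℕ} {ι : Type} (s : Finset ι) (f : ι → Alg n r) (x : Alg n r) :
    (∑ i ∈ s, f i) * x = ∑ i ∈ s, f i * x := by
  simp only [mul_def, map_sum, LinearMap.sum_apply]

theorem mul_sum' {n r : ℕ} {ι : Type} (s : Finset ι) (f : ι → Alg n r) (x : Alg n r) :
    x * (∑ i ∈ s, f i) = ∑ i ∈ s, x * f i :=
  map_sum (mulLin n r x) f s

theorem one_mul' {n r : ℕ} (x : Alg n r) : 1 * x = x := by
  refine alg_induction (p := fun x => 1 * x = x) x (mul_zero' _) ?_ ?_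
  · intro x x' h h'; rw [mul_add', h, h']
  · intro c A
    rw [mul_smul', one_def, sum_mul']
    simp [k_mul_e]

theorem mul_one' {n r : ℕ} (x : Alg n r) : x * 1 = x := by
  refine alg_induction (p := fun x => x * 1 = x) x (zero_mul' _) ?_ ?_
  · intro x x' h h'; rw [add_mul', h, h']
  · intro c A
    rw [smul_mul', one_def, mul_sum']
    simp [e_mul_k]

instance (n r : ℕ) : Ring (Alg n r) :=
  { (inferInstance : AddCommGroup (Alg n r)), (inferInstance : Mul (Alg n r)),
    (inferInstance : One (Alg n r)) with
    mul_assoc := mul_assoc'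
    one_mul := one_mul'
    mul_one := mul_one'
    zero_mul := zero_mul'
    mul_zero := mul_zero'
    left_distrib := mul_add'
    right_distrib := add_mul' }

instance (n r : ℕ) : Algebra ℂ (Alg n r) :=
  Algebra.ofModule smul_mul' mul_smul'

/-! ### The generators `e_i`, `f_i`, `k_l` -/

theorem sum_single {n : ℕ} (p q : Fin n) :
    ∑ i, ∑ j, Matrix.single p q (1 : ℕ) i j = 1 := by
  simp [Matrix.single_apply, ite_and]

/-- The matrix `A + E_{i,q'} - E_{i',q}`. -/
def moveMat {n : ℕ} (A : Matrix (Fin n) (Fin n) ℕ) (i q' i' q : Fin n) :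
    Matrix (Fin n) (Fin n) ℕ :=
  A + Matrix.single i q' 1 - Matrix.single i' q 1

theorem moveMat_add {n : ℕ} (A : Matrix (Fin n) (Fin n) ℕ) (i q' i' q : Fin n)
    (h : 0 < A i' q) :
    moveMat A i q' i' q + Matrix.single i' q 1 = A + Matrix.single i q' 1 := by
  ext a b
  simp only [moveMat, Matrix.add_apply, Matrix.sub_apply, Matrix.single_apply]
  by_cases h2 : i' = a ∧ q = b
  · rw [if_pos h2]
    obtain ⟨rfl, rfl⟩ := h2
    omega
  · rw [if_neg h2]
    omega

/-- The matrix `A + E_{i,q'} - E_{i',q}`, if the `(i', q)` entry of `A` is positive. -/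
def move {n r : ℕ} (A : Mat n r) (i q' i' q : Fin n) (h : 0 < A.1 i' q) : Mat n r :=
  ⟨moveMat A.1 i q' i' q, by
    have h1 := moveMat_add A.1 i q' i' q h
    have h2 := congrArg (fun X : Matrix (Fin n) (Fin n) ℕ => ∑ a, ∑ b, X a b) h1
    simp only [Matrix.add_apply, Finset.sum_add_distrib, sum_single, A.2] at h2
    omega⟩

theorem diag_pos {n r : ℕ} {l : WeakComp n r} {i : Fin n} (h : 0 < l.1 i) :
    0 < (diagMat l).1 i i := by simpa [diagMat] using h

/-- `e_i = ∑_l e_{i,l}`, with `e_{i,l} = e_{diag l - E_{j,j} + E_{i,j}}` for `j = i + 1`, the sum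
being over the `l` with `l_j > 0`. -/
def eGen (n r : ℕ) (i j : Fin n) : Alg n r :=
  ∑ l : WeakComp n r, if h : 0 < l.1 j then e (move (diagMat l) i j j j (diag_pos h)) else 0

/-- `f_i = ∑_l f_{i,l}`, with `f_{i,l} = e_{diag l - E_{i,i} + E_{j,i}}` for `j = i + 1`, the sum
being over the `l` with `l_i > 0`. -/
def fGen (n r : ℕ) (i j : Fin n) : Alg n r :=
  ∑ l : WeakComp n r, if h : 0 < l.1 i then e (move (diagMat l) j i i i (diag_pos h)) else 0

theorem ne_move {n r : ℕ} (A : Mat n r) (i q' i' q : Fin n) (h : 0 < A.1 i' q) (a b : ℕ) :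
    ne (move A i q' i' q h).1 a b + (if (i' : ℕ) < a ∧ b ≤ q then 1 else 0)
      = ne A.1 a b + (if (i : ℕ) < a ∧ b ≤ q' then 1 else 0) := by
  have hs : ∀ p q : Fin n, ne (Matrix.single p q 1) a b
      = if (p : ℕ) < a ∧ b ≤ q then 1 else 0 := by
    intro p q
    unfold ne
    rw [Finset.sum_eq_single p, Finset.sum_eq_single q]
    · simp
    · intro b' _ hb; simp [hb.symm]
    · simp
    · intro a' _ ha; simp [ha.symm]
    · simp
  have hadd : ∀ X Y : Matrix (Fin n) (Fin n) ℕ, ne (X + Y) a b = ne X a b + ne Y a b := by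
    intro X Y
    simp only [ne, ← Finset.sum_add_distrib]
    refine Finset.sum_congr rfl fun a' _ => Finset.sum_congr rfl fun b' _ => ?_
    split_ifs <;> simp
  rw [← hs, ← hs, ← hadd, ← hadd]
  exact congrArg (fun X => ne X a b) (moveMat_add A.1 i q' i' q h)

theorem ro_move {n r : ℕ} (A : Mat n r) (i q' i' q : Fin n) (h : 0 < A.1 i' q) (a : Fin n) :
    (ro (move A i q' i' q h)).1 a + (if a = i' then 1 else 0)
      = (ro A).1 a + (if a = i then 1 else 0) := by
  have h1 := ne_row (move A i q' i' q h) a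
  have h2 := ne_row A a
  have h3 := ne_move A i q' i' q h a 0
  have h4 := ne_move A i q' i' q h (a + 1) 0
  simp only [Fin.ext_iff]
  split_ifs at h3 h4 ⊢ <;> omega

theorem co_move {n r : ℕ} (A : Mat n r) (i q' i' q : Fin n) (h : 0 < A.1 i' q) (b : Fin n) :
    (co (move A i q' i' q h)).1 b + (if b = q then 1 else 0)
      = (co A).1 b + (if b = q' then 1 else 0) := by
  have h1 := ne_col (move A i q' i' q h) b
  have h2 := ne_col A b
  have h3 := ne_move A i q' i' q h n b
  have h4 := ne_move A i q' i' q h n (b + 1)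
  simp only [Fin.ext_iff]
  split_ifs at h3 h4 ⊢ <;> omega

theorem co_move_same {n r : ℕ} (A : Mat n r) (i i' q : Fin n) (h : 0 < A.1 i' q) :
    co (move A i q i' q h) = co A := by
  refine Subtype.ext (funext fun b => ?_)
  have := co_move A i q i' q h b
  omega

theorem ne_diag_row {n r : ℕ} (A : Mat n r) {i j : ℕ} (hi : i ≤ n) (hij : j ≤ i) :
    ne (diagMat (ro A)).1 i j + ne A.1 j 0 = ne A.1 i 0 := by
  have h := ne_diag_lower (ro A) hij
  rwa [ne_row_congr (ro_diag (ro A)) hi, ne_row_congr (ro_diag (ro A)) (hij.trans hi)] at h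

theorem ro_pos {n r : ℕ} {A : Mat n r} {i q : Fin n} (h : 0 < A.1 i q) : 0 < (ro A).1 i :=
  lt_of_lt_of_le h (Finset.single_le_sum (f := fun q => A.1 i q) (fun _ _ => Nat.zero_le _)
    (Finset.mem_univ q))

/-- Multiplication by `e_i`: for `j = i + 1` and `p` the largest column with `A j p > 0`,
`e_i e_A = e_{A + E_{i,p} - E_{j,p}}`. -/
theorem eGen_mul {n r : ℕ} (i j : Fin n) (hij : (j : ℕ) = i + 1) (A : Mat n r) (p : Fin n)
    (hp : 0 < A.1 j p) (hmax : ∀ q, p < q → A.1 j q = 0) :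
    eGen n r i j * e A = e (move A i p j p hp) := by
  have hpos := ro_pos hp
  have hco : ∀ (l : WeakComp n r) (h : 0 < l.1 j),
      co (move (diagMat l) i j j j (diag_pos h)) = l := fun l h => by
    rw [co_move_same, co_diag]
  rw [eGen, Finset.sum_mul, Finset.sum_eq_single (ro A)]
  · rw [dif_pos hpos, e_mul_e, dif_pos (hco _ hpos)]
    congr 1
    refine prod_unique _ (fun a m b ha hm hb => ?_) (fun a b ha hb => ?_)
    · have h1 := ne_move A i p j p hp a b
      have h2 := ne_move _ i j j j (diag_pos hpos) a m
      rcases le_total a m with ham | ham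
      · have h3 := ne_monge A.1 ham hb
        rw [ne_last, ne_last] at h3
        have h4 := ne_diag_upper (ro A) ham
        by_cases hc : a = i + 1 ∧ m ≠ a
        · have h5 := ne_monge A.1 (show a + 1 ≤ m by omega) hb
          rw [ne_last, ne_last] at h5
          have h6 := rect_add_ne A.1 (Nat.le_succ a) hb
          rw [ne_last, ne_last, Nat.succ_eq_add_one] at h6
          by_cases hbp : b ≤ p
          · have h7 : rect A.1 a (a + 1) b n ≠ 0 := by
              rw [Ne, rect_eq_zero]
              intro h8
              have := h8 j p (by omega) (by omega) hbp p.2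
              omega
            split_ifs at h1 h2 <;> omega
          · split_ifs at h1 h2 <;> omega
        · split_ifs at h1 h2 <;> omega
      · have h3 := ne_monge A.1 ham (Nat.zero_le b)
        have h4 := ne_diag_row A ha ham
        split_ifs at h1 h2 <;> omega
    · have h1 := ne_move A i p j p hp a b
      by_cases hc : a = i + 1 ∧ ¬ b ≤ p
      · refine ⟨a + 1, by omega, ?_⟩
        have h2 := ne_move _ i j j j (diag_pos hpos) a (a + 1)
        have h4 := ne_diag_upper (ro A) (Nat.le_succ a)
        have h6 := rect_add_ne A.1 (Nat.le_succ a) hb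
        rw [ne_last, ne_last, Nat.succ_eq_add_one] at h6
        have h7 : rect A.1 a (a + 1) b n = 0 := by
          rw [rect_eq_zero]
          intro a' b' h8 h9 h10 _
          have : a' = j := Fin.ext (by omega)
          rw [this]
          exact hmax b' (Fin.lt_def.2 (by omega))
        simp only [Nat.succ_eq_add_one] at h4
        split_ifs at h1 h2 <;> omega
      · refine ⟨a, ha, ?_⟩
        have h2 := ne_move _ i j j j (diag_pos hpos) a a
        have h4 := ne_diag_upper (ro A) (le_refl a)
        split_ifs at h1 h2 <;> omega
  · intro l _ hl
    by_cases h : 0 < l.1 j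
    · rw [dif_pos h, e_mul_e, dif_neg (by rw [hco l h]; exact hl)]
    · rw [dif_neg h, zero_mul]
  · simp

theorem eGen_mul_zero {n r : ℕ} (i j : Fin n) (A : Mat n r) (h0 : (ro A).1 j = 0) :
    eGen n r i j * e A = 0 := by
  rw [eGen, Finset.sum_mul]
  refine Finset.sum_eq_zero fun l _ => ?_
  by_cases h : 0 < l.1 j
  · rw [dif_pos h, e_mul_e, dif_neg]
    rw [co_move_same, co_diag]
    rintro rfl
    omega
  · rw [dif_neg h, zero_mul]

/-- Multiplication by `f_i`: for `j = i + 1` and `q` the smallest column with `A i q > 0`,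
`f_i e_A = e_{A - E_{i,q} + E_{j,q}}`. -/
theorem fGen_mul {n r : ℕ} (i j : Fin n) (hij : (j : ℕ) = i + 1) (A : Mat n r) (q : Fin n)
    (hq : 0 < A.1 i q) (hmin : ∀ p, p < q → A.1 i p = 0) :
    fGen n r i j * e A = e (move A j q i q hq) := by
  have hpos := ro_pos hq
  have hco : ∀ (l : WeakComp n r) (h : 0 < l.1 i),
      co (move (diagMat l) j i i i (diag_pos h)) = l := fun l h => by
    rw [co_move_same, co_diag]
  rw [fGen, Finset.sum_mul, Finset.sum_eq_single (ro A)]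
  · rw [dif_pos hpos, e_mul_e, dif_pos (hco _ hpos)]
    congr 1
    refine prod_unique _ (fun a m b ha hm hb => ?_) (fun a b ha hb => ?_)
    · have h1 := ne_move A j q i q hq a b
      have h2 := ne_move _ j i i i (diag_pos hpos) a m
      rcases le_total a m with ham | ham
      · have h3 := ne_monge A.1 ham hb
        rw [ne_last, ne_last] at h3
        have h4 := ne_diag_upper (ro A) ham
        split_ifs at h1 h2 <;> omega
      · have h3 := ne_monge A.1 ham (Nat.zero_le b)
        have h4 := ne_diag_row A ha ham
        by_cases hc : a = i + 1 ∧ m ≠ a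
        · obtain ⟨rfl, hma⟩ := hc
          have h5 := ne_monge A.1 (show m ≤ i by omega) (Nat.zero_le b)
          have h7 := rect_add_ne A.1 (Nat.le_succ (i : ℕ)) (Nat.zero_le b)
          rw [Nat.succ_eq_add_one] at h7
          by_cases hbq : b ≤ q
          · split_ifs at h1 h2 <;> omega
          · have h8 : rect A.1 i (i + 1) 0 b ≠ 0 := by
              rw [Ne, rect_eq_zero]
              intro h8
              have := h8 i q (by omega) (by omega) (by omega) (by omega)
              omega
            split_ifs at h1 h2 <;> omega
        · split_ifs at h1 h2 <;> omega
    · have h1 := ne_move A j q i q hq a b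
      by_cases hc : a = i + 1 ∧ b ≤ q
      · obtain ⟨rfl, hbq⟩ := hc
        refine ⟨i, by omega, ?_⟩
        have h2 := ne_move _ j i i i (diag_pos hpos) (i + 1) i
        have h4 := ne_diag_row A ha (Nat.le_succ (i : ℕ))
        have h7 := rect_add_ne A.1 (Nat.le_succ (i : ℕ)) (Nat.zero_le b)
        rw [Nat.succ_eq_add_one] at h7
        have h8 : rect A.1 i (i + 1) 0 b = 0 := by
          rw [rect_eq_zero]
          intro a' b' h8 h9 _ h10
          have : a' = i := Fin.ext (by omega)
          rw [this]
          exact hmin b' (Fin.lt_def.2 (by omega))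
        split_ifs at h1 h2 <;> omega
      · refine ⟨a, ha, ?_⟩
        have h2 := ne_move _ j i i i (diag_pos hpos) a a
        have h4 := ne_diag_upper (ro A) (le_refl a)
        split_ifs at h1 h2 <;> omega
  · intro l _ hl
    by_cases h : 0 < l.1 i
    · rw [dif_pos h, e_mul_e, dif_neg (by rw [hco l h]; exact hl)]
    · rw [dif_neg h, zero_mul]
  · simp

theorem fGen_mul_zero {n r : ℕ} (i j : Fin n) (A : Mat n r) (h0 : (ro A).1 i = 0) :
    fGen n r i j * e A = 0 := by
  rw [fGen, Finset.sum_mul]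
  refine Finset.sum_eq_zero fun l _ => ?_
  by_cases h : 0 < l.1 i
  · rw [dif_pos h, e_mul_e, dif_neg]
    rw [co_move_same, co_diag]
    rintro rfl
    omega
  · rw [dif_neg h, zero_mul]


theorem move_entry {n r : ℕ} (A : Mat n r) (i q' i' q : Fin n) (h : 0 < A.1 i' q) (a b : Fin n) :
    (move A i q' i' q h).1 a b + (if i' = a ∧ q = b then 1 else 0)
      = A.1 a b + (if i = a ∧ q' = b then 1 else 0) :=
  congrFun (congrFun (moveMat_add A.1 i q' i' q h) a) b

/-- Moving a unit back and forth. -/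
theorem move_move {n r : ℕ} (A : Mat n r) (i q' i' q : Fin n) (h : 0 < A.1 i' q)
    (h' : 0 < (move A i q' i' q h).1 i q') : move (move A i q' i' q h) i' q i q' h' = A := by
  refine Subtype.ext (Matrix.ext fun a b => ?_)
  have h1 := move_entry A i q' i' q h a b
  have h2 := move_entry _ i' q i q' h' a b
  split_ifs at h1 h2 <;> omega

/-- The algebra is generated by the elements `e_i`, `f_i` and `k_l`. -/
theorem adjoin_generators (n r : ℕ) :
    Algebra.adjoin ℂ ({x : Alg n r | (∃ l, x = k l) ∨ ∃ i j : Fin n, (j : ℕ) = i + 1 ∧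
      (x = eGen n r i j ∨ x = fGen n r i j)}) = ⊤ := by
  set G := Algebra.adjoin ℂ ({x : Alg n r | (∃ l, x = k l) ∨ ∃ i j : Fin n, (j : ℕ) = i + 1 ∧
      (x = eGen n r i j ∨ x = fGen n r i j)}) with hG
  have hk : ∀ l, k l ∈ G := fun l => Algebra.subset_adjoin (Or.inl ⟨l, rfl⟩)
  have he : ∀ i j : Fin n, (j : ℕ) = i + 1 → eGen n r i j ∈ G := fun i j h =>
    Algebra.subset_adjoin (Or.inr ⟨i, j, h, Or.inl rfl⟩)
  have hf : ∀ i j : Fin n, (j : ℕ) = i + 1 → fGen n r i j ∈ G := fun i j h =>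
    Algebra.subset_adjoin (Or.inr ⟨i, j, h, Or.inr rfl⟩)
  -- the distance from being a diagonal matrix
  let wt : Mat n r → ℕ := fun A => ∑ a : Fin n, ∑ b : Fin n,
    A.1 a b * ((a : ℕ) - b + ((b : ℕ) - a))
  have hwt : ∀ (A : Mat n r) (i i' q : Fin n) (h : 0 < A.1 i' q),
      wt (move A i q i' q h) + ((i' : ℕ) - q + ((q : ℕ) - i'))
        = wt A + ((i : ℕ) - q + ((q : ℕ) - i)) := by
    intro A i i' q h
    have hs : ∀ p q : Fin n, ∑ a : Fin n, ∑ b : Fin n,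
        (if p = a ∧ q = b then 1 else 0) * ((a : ℕ) - b + ((b : ℕ) - a))
          = (p : ℕ) - q + ((q : ℕ) - p) := by
      intro p q
      simp [ite_and]
    rw [← hs, ← hs]
    simp only [wt, ← Finset.sum_add_distrib, ← add_mul, move_entry A i q i' q h]
  have main : ∀ (w : ℕ) (A : Mat n r), wt A = w → e A ∈ G := by
    intro w
    induction w using Nat.strong_induction_on with
    | _ w ih =>
      intro A hA
      by_cases hlow : ∃ q : Fin n, ∃ a : Fin n, q < a ∧ 0 < A.1 a q
      · -- the first column with an entry below the diagonal
        obtain ⟨q, hq, hmin⟩ := WellFounded.has_min (wellFounded_lt (α := Fin n))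
          {q | ∃ a : Fin n, q < a ∧ 0 < A.1 a q} hlow
        obtain ⟨a, hqa, ha⟩ := hq
        rw [Fin.lt_def] at hqa
        let i : Fin n := ⟨a - 1, by omega⟩
        have hia : (a : ℕ) = i + 1 := by simp only [i]; omega
        have hpos : 0 < (move A i q a q ha).1 i q := by
          have := move_entry A i q a q ha i q
          have hne : ¬ (a = i ∧ q = q) := fun h => by
            have := congrArg Fin.val h.1; omega
          rw [if_neg hne, if_pos ⟨rfl, rfl⟩] at this
          omega
        have h1 := fGen_mul i a hia (move A i q a q ha) q hpos (fun p hp => by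
          have := move_entry A i q a q ha i p
          have hne : ¬ (i = i ∧ q = p) := fun h => absurd h.2 hp.ne'
          rw [if_neg hne] at this
          have h0 : A.1 i p = 0 := by
            by_contra hcon
            refine hmin p ⟨i, ?_, Nat.pos_of_ne_zero hcon⟩ hp
            rw [Fin.lt_def] at hp ⊢; omega
          omega)
        rw [move_move] at h1
        rw [← h1]
        refine mul_mem (hf i a hia) (ih _ ?_ _ rfl)
        have := hwt A i a q ha
        omega
      by_cases hup : ∃ q : Fin n, ∃ a : Fin n, a < q ∧ 0 < A.1 a q
      · -- the last column with an entry above the diagonal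
        obtain ⟨q, hq, hmax⟩ := WellFounded.has_min (wellFounded_gt (α := Fin n))
          {q | ∃ a : Fin n, a < q ∧ 0 < A.1 a q} hup
        obtain ⟨a, hqa, ha⟩ := hq
        rw [Fin.lt_def] at hqa
        let i : Fin n := ⟨a + 1, by omega⟩
        have hia : (i : ℕ) = a + 1 := rfl
        have hpos : 0 < (move A i q a q ha).1 i q := by
          have := move_entry A i q a q ha i q
          have hne : ¬ (a = i ∧ q = q) := fun h => by
            have := congrArg Fin.val h.1; omega
          rw [if_neg hne, if_pos ⟨rfl, rfl⟩] at this
          omega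
        have h1 := eGen_mul a i hia (move A i q a q ha) q hpos (fun p hp => by
          have := move_entry A i q a q ha i p
          have hne : ¬ (i = i ∧ q = p) := fun h => absurd h.2 hp.ne
          rw [if_neg hne] at this
          have h0 : A.1 i p = 0 := by
            by_contra hcon
            refine hmax p ⟨i, ?_, Nat.pos_of_ne_zero hcon⟩ hp
            rw [Fin.lt_def] at hp ⊢; omega
          omega)
        rw [move_move] at h1
        rw [← h1]
        refine mul_mem (he a i hia) (ih _ ?_ _ rfl)
        have := hwt A i a q ha
        omega
      · have : A = diagMat (ro A) := by
          refine Subtype.ext (Matrix.ext fun a b => ?_)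
          push Not at hlow hup
          by_cases hab : a = b
          · subst hab
            simp only [diagMat, Matrix.diagonal_apply_eq, ro]
            refine (Finset.sum_eq_single a (fun b _ hb => ?_) (by simp)).symm
            rcases lt_or_gt_of_ne hb with h | h
            · have := hlow b a h; omega
            · have := hup b a h; omega
          · simp only [diagMat, Matrix.diagonal_apply_ne _ hab]
            rcases lt_or_gt_of_ne hab with h | h
            · have := hup b a h; omega
            · have := hlow b a h; omega
        rw [this]
        exact hk _
  refine eq_top_iff.2 fun x _ => ?_
  refine alg_induction (p := fun x => x ∈ G) x G.zero_mem (fun _ _ => G.add_mem) ?_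
  intro c A
  exact G.smul_mem (main _ A rfl) c

/-! ### The projective module `P_l` -/

/-- Every `2 × 2` submatrix has at least one zero on its diagonal. -/
def IsOpenMat {n : ℕ} (M : Matrix (Fin n) (Fin n) ℕ) : Prop :=
  ∀ i i' j j' : Fin n, i < i' → j < j' → M i j = 0 ∨ M i' j' = 0

/-- The matrix `A(α; v)`: the columns of `A` in the `v`-th block of `α` are kept, the others are
replaced by zero. -/
def colBlock {n : ℕ} (c : Composition n) (v : Fin c.length) (A : Matrix (Fin n) (Fin n) ℕ) :
    Matrix (Fin n) (Fin n) ℕ :=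
  fun i j => if c.index j = v then A i j else 0

/-- `A` is open on columns with respect to the strong composition `c` of `n`. -/
def OpenOnColumns {n : ℕ} (c : Composition n) (A : Matrix (Fin n) (Fin n) ℕ) : Prop :=
  ∀ v : Fin c.length, IsOpenMat (colBlock c v A)

/-- The first position of the `v`-th block of `c`. -/
def firstPos {n : ℕ} (c : Composition n) (v : Fin c.length) : Fin n :=
  c.embedding v ⟨0, c.blocks_pos' v v.2⟩

/-- The last position of the `v`-th block of `c`. -/
def lastPos {n : ℕ} (c : Composition n) (v : Fin c.length) : Fin n :=
  c.embedding v ⟨c.blocksFun v - 1, Nat.sub_lt (c.blocks_pos' v v.2) Nat.one_pos⟩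

/-- `c` is maximal with respect to `l`: each block of `l` cut out by `c` is either `(0)` or has
neither its first nor its last entry equal to zero. -/
def IsMaximalFor {n r : ℕ} (c : Composition n) (l : WeakComp n r) : Prop :=
  ∀ v : Fin c.length, (c.blocksFun v = 1 ∧ l.1 (firstPos c v) = 0) ∨
    (l.1 (firstPos c v) ≠ 0 ∧ l.1 (lastPos c v) ≠ 0)

/-- The index set of `B^l`: the matrices `A` with `co A = l` that are not open on columns with
respect to any `α ≠ (1, …, 1)` that is maximal with respect to `l`. -/
def BSet {n r : ℕ} (l : WeakComp n r) : Set (Mat n r) :=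
  {A | co A = l ∧ ∀ c : Composition n, IsMaximalFor c l → c ≠ Composition.ones n →
    ¬ OpenOnColumns c A.1}

/-- The index set of `β^l`: the column block diagonal matrices, that is, those such that
`A i j > 0` forces `A i' j' = 0` for `i' ≤ i`, `j' > j`, with column sums `l`. -/
def cbSet {n r : ℕ} (l : WeakComp n r) : Set (Mat n r) :=
  {A | co A = l ∧ ∀ i j : Fin n, 0 < A.1 i j → ∀ i' j' : Fin n, i' ≤ i → j < j' → A.1 i' j' = 0}

theorem openOnColumns_iff {n : ℕ} (c : Composition n) (A : Matrix (Fin n) (Fin n) ℕ) :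
    OpenOnColumns c A ↔ ∀ v : Fin c.length, ∀ i k, i ≤ n → c.sizeUpTo v ≤ k →
      k ≤ c.sizeUpTo (v + 1) →
      ne A i k = ne A i (c.sizeUpTo v) ∨
      ne A i k + ne A n (c.sizeUpTo (v + 1)) = ne A i (c.sizeUpTo (v + 1)) + ne A n k := by
  have key : ∀ (v : Fin c.length) (j : Fin n), c.index j = v ↔
      c.sizeUpTo v ≤ j ∧ (j : ℕ) < c.sizeUpTo (v + 1) := fun v j => by
    rw [eq_comm, ← c.mem_range_embedding_iff', c.mem_range_embedding_iff]
  refine forall_congr' fun v => ?_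
  have e1 : ∀ i k, i ≤ n → c.sizeUpTo v ≤ k →
      (ne A i k = ne A i (c.sizeUpTo v) ↔ rect A 0 i (c.sizeUpTo v) k = 0) := by
    intro i k _ hk
    have := rect_add_ne A (Nat.zero_le i) hk
    rw [ne_zero_left, ne_zero_left] at this
    omega
  have e2 : ∀ i k, i ≤ n → k ≤ c.sizeUpTo (v + 1) →
      (ne A i k + ne A n (c.sizeUpTo (v + 1)) = ne A i (c.sizeUpTo (v + 1)) + ne A n k ↔
        rect A i n k (c.sizeUpTo (v + 1)) = 0) := by
    intro i k hi hk
    have := rect_add_ne A hi hk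
    omega
  constructor
  · intro h i k hi hk hk'
    rw [e1 i k hi hk, e2 i k hi hk', rect_eq_zero, rect_eq_zero]
    by_contra hcon
    push Not at hcon
    obtain ⟨⟨a, b, _, h2, h3, h4, h5⟩, a', b', h6, _, h8, h9, h10⟩ := hcon
    have hb : c.index b = v := (key v b).2 ⟨h3, by omega⟩
    have hb' : c.index b' = v := (key v b').2 ⟨by omega, h9⟩
    have := h a a' b b' (Fin.lt_def.2 (by omega)) (Fin.lt_def.2 (by omega))
    simp only [colBlock, if_pos hb, if_pos hb'] at this
    tauto
  · intro h i i' j j' hi hj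
    by_cases hb : c.index j = v
    · by_cases hb' : c.index j' = v
      · simp only [colBlock, if_pos hb, if_pos hb']
        have h1 := (key v j).1 hb
        have h2 := (key v j').1 hb'
        rw [Fin.lt_def] at hi hj
        have := h (i + 1) (j + 1) i.2 (by omega) (by omega)
        rw [e1 _ _ i.2 (by omega), e2 _ _ i.2 (by omega), rect_eq_zero, rect_eq_zero] at this
        rcases this with h3 | h3
        · exact Or.inl (h3 i j (by omega) (by omega) (by omega) (by omega))
        · exact Or.inr (h3 i' j' (by omega) (by omega) (by omega) (by omega))
      · right; simp only [colBlock, if_neg hb']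
    · left; simp only [colBlock, if_neg hb]

theorem OpenOnColumns.prod {n r : ℕ} {C A : Mat n r} (h : co C = ro A) {c : Composition n}
    (hA : OpenOnColumns c A.1) : OpenOnColumns c (prod C A h).1 := by
  rw [openOnColumns_iff] at hA ⊢
  intro v i k hi hk hk'
  have hw : c.sizeUpTo (v + 1) ≤ n := c.sizeUpTo_le _
  have hu : c.sizeUpTo v ≤ n := c.sizeUpTo_le _
  have hkn : k ≤ n := hk'.trans hw
  obtain ⟨j, hj, h1⟩ := ne_prod_exists h hi hkn
  rw [ne_prod_col h hw, ne_prod_col h hkn]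
  rcases hA v j k hj hk hk' with h2 | h2
  · left
    have h3 := ne_prod_le h hi hj hu
    have h4 := ne_monge (SchurZero.prod C A h).1 (Nat.zero_le i) hk
    rw [ne_zero_left, ne_zero_left] at h4
    omega
  · right
    have h3 := ne_prod_le h hi hj hw
    have h4 := ne_monge (SchurZero.prod C A h).1 hi hk'
    rw [ne_prod_col h hw, ne_prod_col h hkn] at h4
    omega

/-- The complement of `B^l` is stable under left multiplication. -/
theorem prod_notMem_BSet {n r : ℕ} {l : WeakComp n r} {C A : Mat n r} (h : co C = ro A)
    (hA : A ∉ BSet l) : prod C A h ∉ BSet l := by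
  intro hB
  refine hA ⟨by rw [← hB.1, co_prod], fun c hc hc' ho => ?_⟩
  exact hB.2 c hc hc' (ho.prod h)

theorem cb_iff {n r : ℕ} (A : Mat n r) :
    (∀ i j : Fin n, 0 < A.1 i j → ∀ i' j' : Fin n, i' ≤ i → j < j' → A.1 i' j' = 0) ↔
    ∀ j, j ≤ n → ∃ i, i ≤ n ∧ ne A.1 i j = 0 ∧ ne A.1 n j + ne A.1 i 0 = r := by
  have e1 : ∀ i j, j ≤ n → (ne A.1 i j = 0 ↔ rect A.1 0 i j n = 0) := by
    intro i j hj
    have := rect_add_ne A.1 (Nat.zero_le i) hj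
    rw [ne_zero_left, ne_zero_left, ne_last] at this
    omega
  have e2 : ∀ i j, i ≤ n → ne A.1 i j = 0 →
      (ne A.1 n j + ne A.1 i 0 = r ↔ rect A.1 i n 0 j = 0) := by
    intro i j hi h0
    have := rect_add_ne A.1 hi (Nat.zero_le j)
    rw [ne_full'] at this
    omega
  constructor
  · intro h j hj
    obtain ⟨i, hi, h0, hmax⟩ : ∃ i, i ≤ n ∧ ne A.1 i j = 0 ∧
        ∀ i', i < i' → i' ≤ n → ne A.1 i' j ≠ 0 :=
      ⟨Nat.findGreatest (fun i => ne A.1 i j = 0) n, Nat.findGreatest_le n,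
        Nat.findGreatest_spec (P := fun i => ne A.1 i j = 0) (Nat.zero_le n) (ne_zero_left _ _),
        fun i' h1 h2 =>
          Nat.findGreatest_is_greatest (P := fun i => ne A.1 i j = 0) h1 h2⟩
    refine ⟨i, hi, h0, ?_⟩
    rw [e2 i j hi h0, rect_eq_zero]
    intro a b h1 h2 _ h4
    have h5 := hmax (i + 1) (by omega) (by omega)
    rw [Ne, e1 _ _ hj, rect_eq_zero] at h5
    push Not at h5
    obtain ⟨a', b', _, h7, h8, _, h10⟩ := h5
    by_contra hab
    exact h10 (h a b (Nat.pos_of_ne_zero hab) a' b' (Fin.le_def.2 (by omega))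
      (Fin.lt_def.2 (by omega)))
  · intro h i j hij i' j' hi hj
    obtain ⟨m, hm, h1, h2⟩ := h (j + 1) j.2
    rw [e2 _ _ hm h1, rect_eq_zero] at h2
    rw [e1 _ _ j.2, rect_eq_zero] at h1
    rw [Fin.le_def] at hi
    rw [Fin.lt_def] at hj
    by_cases him : (i : ℕ) < m
    · exact h1 i' j' (by omega) (by omega) (by omega) (by omega)
    · have := h2 i j (by omega) (by omega) (by omega) (by omega)
      omega

/-- The complement of `β^l` is stable under left multiplication. -/
theorem prod_notMem_cbSet {n r : ℕ} {l : WeakComp n r} {C A : Mat n r} (h : co C = ro A)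
    (hA : A ∉ cbSet l) : prod C A h ∉ cbSet l := by
  intro hB
  refine hA ⟨by rw [← hB.1, co_prod], ?_⟩
  have h2 := hB.2
  rw [cb_iff] at h2 ⊢
  intro j hj
  obtain ⟨i, hi, h3, h4⟩ := h2 j hj
  rw [ne_prod_col h hj, ne_prod_row h hi] at h4
  obtain ⟨m, hm, h5⟩ := ne_prod_exists h hi hj
  have h6 := ne_compl h hm
  have h7 := ne_monge C.1 hi (Nat.zero_le m)
  have h8 := ne_monge A.1 hm (Nat.zero_le j)
  rw [ne_full'] at h7 h8
  exact ⟨m, hm, by omega, by omega⟩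

/-- The `ℂ`-span of `B^l`, with basis indexed by `BSet l`. -/
def P {n r : ℕ} (l : WeakComp n r) : Type := BSet l →₀ ℂ

instance {n r : ℕ} (l : WeakComp n r) : AddCommGroup (P l) :=
  inferInstanceAs (AddCommGroup (BSet l →₀ ℂ))

instance {n r : ℕ} (l : WeakComp n r) : Module ℂ (P l) :=
  inferInstanceAs (Module ℂ (BSet l →₀ ℂ))

/-- The basis element of `P_l` given by `A ∈ B^l`. -/
def eP {n r : ℕ} {l : WeakComp n r} (A : BSet l) : P l := Finsupp.single A 1

/-- The inclusion of the span of `B^l` in the algebra, `e_A ↦ e_A`. -/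
def incl {n r : ℕ} (l : WeakComp n r) : P l →ₗ[ℂ] Alg n r :=
  (Finsupp.lmapDomain ℂ ℂ Subtype.val : (BSet l →₀ ℂ) →ₗ[ℂ] (Mat n r →₀ ℂ))

/-- The projection of the algebra to the span of `B^l`: `e_A ↦ e_A` if `e_A ∈ B^l`, and
`e_A ↦ 0` otherwise. -/
def proj {n r : ℕ} (l : WeakComp n r) : Alg n r →ₗ[ℂ] P l :=
  (Finsupp.lsubtypeDomain (BSet l) : (Mat n r →₀ ℂ) →ₗ[ℂ] (BSet l →₀ ℂ))

theorem incl_eP {n r : ℕ} {l : WeakComp n r} (A : BSet l) : incl l (eP A) = e A.1 :=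
  Finsupp.mapDomain_single

theorem proj_e_mem {n r : ℕ} {l : WeakComp n r} {A : Mat n r} (hA : A ∈ BSet l) :
    proj l (e A) = eP ⟨A, hA⟩ := by
  classical
  refine Finsupp.ext fun B => ?_
  change (Finsupp.single A (1 : ℂ) : Mat n r →₀ ℂ) B.1 =
    (Finsupp.single ⟨A, hA⟩ (1 : ℂ) : BSet l →₀ ℂ) B
  rw [Finsupp.single_apply, Finsupp.single_apply]
  simp only [Subtype.ext_iff]

theorem proj_e_notMem {n r : ℕ} {l : WeakComp n r} {A : Mat n r} (hA : A ∉ BSet l) :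
    proj l (e A) = 0 := by
  refine Finsupp.ext fun B => ?_
  change (Finsupp.single A (1 : ℂ) : Mat n r →₀ ℂ) B.1 = 0
  exact Finsupp.single_eq_of_ne (fun h => hA (h ▸ B.2))

theorem P_induction {n r : ℕ} {l : WeakComp n r} {p : P l → Prop} (x : P l) (h0 : p 0)
    (hadd : ∀ x y, p x → p y → p (x + y)) (hs : ∀ (c : ℂ) (A : BSet l), p (c • eP A)) : p x := by
  refine Finsupp.induction_linear (motive := p) x h0 hadd fun A c => ?_
  have : (Finsupp.single A c : BSet l →₀ ℂ) = c • Finsupp.single A 1 := by simp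
  rw [this]
  exact hs c A

theorem proj_incl {n r : ℕ} {l : WeakComp n r} (x : P l) : proj l (incl l x) = x := by
  refine P_induction (p := fun x => proj l (incl l x) = x) x (by simp) ?_ ?_
  · intro x y hx hy; simp only [map_add, hx, hy]
  · intro c A; simp only [map_smul, incl_eP, proj_e_mem A.2]

/-- The kernel of the projection is a left ideal. -/
theorem proj_mul {n r : ℕ} {l : WeakComp n r} (a x : Alg n r) :
    proj l (a * incl l (proj l x)) = proj l (a * x) := by
  refine alg_induction (p := fun x => proj l (a * incl l (proj l x)) = proj l (a * x)) x
    (by simp) ?_ ?_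
  · intro x y hx hy; simp only [map_add, mul_add, hx, hy]
  intro c A
  by_cases hA : A ∈ BSet l
  · simp only [map_smul, proj_e_mem hA, incl_eP]
  refine alg_induction
    (p := fun a => proj l (a * incl l (proj l (c • e A))) = proj l (a * (c • e A))) a
    (by simp) ?_ ?_
  · intro x y hx hy; simp only [map_add, add_mul, hx, hy]
  intro d C
  simp only [map_smul, proj_e_notMem hA, smul_zero, map_zero, mul_zero, smul_mul_assoc,
    mul_smul_comm, e_mul_e]
  split_ifs with h
  · rw [proj_e_notMem (prod_notMem_BSet h hA)]; simp
  · simp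

/-- The action on `P_l`: on basis elements, `e_C · e_A = e_B` if `e_C e_A = e_B` in the algebra
and `e_B ∈ B^l`, and `e_C · e_A = 0` otherwise (see `e_smul_eP`). -/
instance {n r : ℕ} (l : WeakComp n r) : Module (Alg n r) (P l) where
  smul a x := proj l (a * incl l x)
  one_smul x := by
    change proj l (1 * incl l x) = x
    rw [one_mul, proj_incl]
  mul_smul a b x := by
    change proj l (a * b * incl l x) = proj l (a * incl l (proj l (b * incl l x)))
    rw [proj_mul, mul_assoc]
  smul_zero a := by
    change proj l (a * incl l 0) = 0
    simp
  smul_add a x y := by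
    change proj l (a * incl l (x + y)) = proj l (a * incl l x) + proj l (a * incl l y)
    simp only [map_add, mul_add]
  add_smul a b x := by
    change proj l ((a + b) * incl l x) = proj l (a * incl l x) + proj l (b * incl l x)
    simp only [map_add, add_mul]
  zero_smul x := by
    change proj l (0 * incl l x) = 0
    simp

theorem smul_def {n r : ℕ} {l : WeakComp n r} (a : Alg n r) (x : P l) :
    a • x = proj l (a * incl l x) := rfl

open Classical in
theorem e_smul_eP {n r : ℕ} {l : WeakComp n r} (C : Mat n r) (A : BSet l) :
    e C • eP A = if h : ∃ h : co C = ro A.1, prod C A.1 h ∈ BSet l then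
      eP ⟨prod C A.1 h.1, h.2⟩ else 0 := by
  rw [smul_def, incl_eP, e_mul_e]
  by_cases h : co C = ro A.1
  · rw [dif_pos h]
    by_cases h' : prod C A.1 h ∈ BSet l
    · rw [dif_pos ⟨h, h'⟩, proj_e_mem h']
    · rw [dif_neg (fun hh => h' hh.2), proj_e_notMem h']
  · rw [dif_neg h, dif_neg (fun hh => h hh.1), map_zero]

instance {n r : ℕ} (l : WeakComp n r) : IsScalarTower ℂ (Alg n r) (P l) where
  smul_assoc c a x := by
    rw [smul_def, smul_def, smul_mul_assoc, map_smul]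

/-! ### The submodule `N_l`, the quotient `S_l`, and tops -/

/-- The submodule `N_l` of `P_l`: the `ℂ`-span of `B^l \ β^l`. -/
def N {n r : ℕ} (l : WeakComp n r) : Submodule (Alg n r) (P l) where
  __ := (Submodule.span ℂ {x : P l | ∃ A : BSet l, A.1 ∉ cbSet l ∧ x = eP A}).toAddSubmonoid
  smul_mem' a x hx := by
    change a • x ∈ Submodule.span ℂ {x : P l | ∃ A : BSet l, A.1 ∉ cbSet l ∧ x = eP A}
    change x ∈ Submodule.span ℂ {x : P l | ∃ A : BSet l, A.1 ∉ cbSet l ∧ x = eP A} at hx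
    induction hx using Submodule.span_induction with
    | zero => rw [smul_zero]; exact Submodule.zero_mem _
    | add x y _ _ hx hy => rw [smul_add]; exact Submodule.add_mem _ hx hy
    | smul c x _ hx =>
      rw [smul_def, map_smul, mul_smul_comm, map_smul, ← smul_def]
      exact Submodule.smul_mem _ c hx
    | mem x hx =>
      obtain ⟨A, hA, rfl⟩ := hx
      refine alg_induction (p := fun a => a • eP A ∈
        Submodule.span ℂ {x : P l | ∃ A : BSet l, A.1 ∉ cbSet l ∧ x = eP A}) a ?_ ?_ ?_
      · rw [zero_smul]; exact Submodule.zero_mem _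
      · intro a b ha hb; rw [add_smul]; exact Submodule.add_mem _ ha hb
      · intro c C
        rw [smul_assoc, e_smul_eP]
        refine Submodule.smul_mem _ c ?_
        split_ifs with h
        · exact Submodule.subset_span ⟨_, prod_notMem_cbSet h.1 hA, rfl⟩
        · exact Submodule.zero_mem _

theorem coe_N {n r : ℕ} (l : WeakComp n r) : (N l : Set (P l)) =
    Submodule.span ℂ {x : P l | ∃ A : BSet l, A.1 ∉ cbSet l ∧ x = eP A} := rfl

/-- `S_l = P_l / N_l`. -/
abbrev S {n r : ℕ} (l : WeakComp n r) : Type := P l ⧸ N l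

/-- The top of a module: its quotient by its radical, the intersection of its maximal
submodules. -/
abbrev top (R M : Type*) [Ring R] [AddCommGroup M] [Module R M] : Type _ :=
  M ⧸ Module.jacobson R M

end

end SchurZero

namespace SchurZero

/-! ### Diagonal and column block diagonal matrices -/

/-! `P_l` is generated by `k_l`, and the theorem splits into two facts about `N_l`. It is a maximal
submodule, so it contains the radical; and it is superfluous, so every maximal submodule contains
it.

Maximality (`isCoatom_N`). A column block diagonal matrix with column sums `l` is determined by its
row sums (`cbSet_ext`), and its transpose is a left inverse: `e_{Aᵀ} e_A = k_l`
(`transposeMat_prod`). If `B` is another such matrix, then `co Aᵀ = ro A ≠ ro B`, so `e_{Aᵀ} e_B =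
0`. Thus `e_{Aᵀ}` sends `x` to its `A`-coefficient times `k_l`, modulo `N_l`. A submodule strictly
above `N_l` therefore contains the generator. This works for every `l`.

Superfluity (`eq_top_of_sup_N_eq_top`). If `M + N_l = P_l`, then `k_l - y ∈ M` for some `y ∈ N_l`,
and `e_A = e_A (k_l - y) + e_A y`. The terms of `e_A y` are multiples of `e_{AC}` with `ro C = co C
= l` and `C` not diagonal. Right multiplication by such a `C` never lowers a corner sum
(`ne_le_ne_prod`), and it moves every `A` in `B^l` (`prod_ne_self`). Hence the total of the corner
sums grows strictly; it is bounded, so descending induction puts every `e_A` in `M`.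

The form of `B^l` and the condition on `l` enter in `prod_ne_self`. If `AC = A` with `C` not
diagonal, then two adjacent columns of `A` form an open matrix. The condition on `l` makes both of
their sums nonzero, so the composition that joins just these two columns is maximal for `l`, and `A`
would be excluded from `B^l`. -/

/-- A matrix with equal row and column sums and no entry above the diagonal is diagonal. -/
theorem eq_diagMat_of_ne_eq_zero {n r : ℕ} {l : WeakComp n r} {C : Mat n r} (hro : ro C = l)
    (hco : co C = l) (h : ∀ j, j ≤ n → ne C.1 j j = 0) : C = diagMat l := by
  have hup : ∀ a b : Fin n, a < b → C.1 a b = 0 := by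
    intro a b hab
    have h1 := rect_add_ne C.1 (Nat.zero_le b) b.2.le
    rw [h b b.2.le, ne_zero_left, ne_last, ne_zero_left, add_zero, add_zero, rect_eq_zero] at h1
    exact h1 a b (Nat.zero_le _) hab le_rfl b.2
  have hlow : ∀ a b : Fin n, b < a → C.1 a b = 0 := by
    intro a b hab
    -- Equal row and column sums make the south-west block at `(a, a)` have the same total as the
    -- north-east one, which is zero.
    have h1 := rect_add_ne C.1 a.2.le (Nat.zero_le a)
    have h2 := ne_compl (hco.trans hro.symm) a.2.le
    rw [ne_full', h a a.2.le] at h1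
    have h3 : rect C.1 a n 0 a = 0 := by omega
    rw [rect_eq_zero] at h3
    exact h3 a b le_rfl a.2 (Nat.zero_le _) hab
  refine Subtype.ext (Matrix.ext fun a b => ?_)
  by_cases hab : a = b
  · subst hab
    rw [← hro]
    simp only [diagMat, Matrix.diagonal_apply_eq, ro]
    refine (Finset.sum_eq_single a (fun b _ hb => ?_) (by simp)).symm
    rcases lt_or_gt_of_ne hb with h | h
    · exact hlow a b h
    · exact hup a b h
  · simp only [diagMat, Matrix.diagonal_apply_ne _ hab]
    rcases lt_or_gt_of_ne hab with h | h
    · exact hup a b h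
    · exact hlow a b h

theorem diagMat_mem_cbSet {n r : ℕ} (l : WeakComp n r) : diagMat l ∈ cbSet l := by
  refine ⟨co_diag l, fun i j hij i' j' hi hj => ?_⟩
  have h : i = j := by
    by_contra h
    simp [diagMat, Matrix.diagonal_apply_ne _ h] at hij
  subst h
  exact Matrix.diagonal_apply_ne _ (hi.trans_lt hj).ne

/-- A block of length at least two in a maximal composition starts and ends at nonzero entries of
`l`. These two diagonal entries form a `2 × 2` submatrix with no zero on its diagonal, so the block
is not open. -/
theorem diagMat_mem_BSet {n r : ℕ} (l : WeakComp n r) : diagMat l ∈ BSet l := by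
  refine ⟨co_diag l, fun c hc hc' ho => ?_⟩
  obtain ⟨s, hs, hs1⟩ := Composition.ne_ones_iff.1 hc'
  obtain ⟨v, hv⟩ := List.get_of_mem hs
  have hv1 : 1 < c.blocksFun v := by
    change 1 < c.blocks.get v
    rwa [hv]
  rcases hc v with h | ⟨h1, h2⟩
  · omega
  have hlt : firstPos c v < lastPos c v := by
    refine (c.embedding v).strictMono (Fin.lt_def.2 ?_)
    simp only
    omega
  have h3 := ho v (firstPos c v) (lastPos c v) (firstPos c v) (lastPos c v) hlt hlt
  simp only [colBlock, firstPos, lastPos, Composition.index_embedding, if_true, diagMat,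
    Matrix.diagonal_apply_eq] at h3
  exact h3.elim h1 h2

/-- The corner sums of a column block diagonal matrix are determined by its row and column sums. -/
theorem ne_of_mem_cbSet {n r : ℕ} {l : WeakComp n r} {A : Mat n r} (hA : A ∈ cbSet l) {i j : ℕ}
    (hi : i ≤ n) (hj : j ≤ n) : ne A.1 i j = ne A.1 i 0 + ne A.1 n j - r := by
  obtain ⟨m, hm, h0, h1⟩ := (cb_iff A).1 hA.2 j hj
  -- The cut `m` separates the rows meeting columns `< j` from those meeting columns `≥ j`. Above it
  -- `ne A i j` vanishes and the difference is truncated to zero; below it the difference is exact.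
  rcases le_total i m with h | h
  · have h2 := ne_monge A.1 h hj
    have h3 := ne_monge A.1 h (Nat.zero_le j)
    have h4 := ne_monge A.1 hi (Nat.zero_le j)
    rw [ne_last, ne_last] at h2
    omega
  · have h3 := ne_monge A.1 h (Nat.zero_le j)
    have h4 := ne_monge A.1 hi (Nat.zero_le j)
    rw [ne_full'] at h4
    omega

/-- Distinct elements of `β^l` have distinct row sums, so an idempotent `k` on the left tells them
apart. -/
theorem cbSet_ext {n r : ℕ} {l : WeakComp n r} {A B : Mat n r} (hA : A ∈ cbSet l)
    (hB : B ∈ cbSet l) (h : ro A = ro B) : A = B := by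
  have hcol : ∀ j, j ≤ n → ne A.1 n j = ne B.1 n j := by
    intro j hj
    -- Comparing with `diagMat l` expresses `ne A n j` through `l` alone.
    have h1 := ne_compl (B := diagMat l) (hA.1.trans (ro_diag l).symm) hj
    have h2 := ne_compl (B := diagMat l) (hB.1.trans (ro_diag l).symm) hj
    omega
  refine Subtype.ext (ne_inj fun i j hi hj => ?_)
  rw [ne_of_mem_cbSet hA hi hj, ne_of_mem_cbSet hB hi hj, ne_row_congr h hi, hcol j hj]

/-! ### Left inverses of column block diagonal matrices -/

/-- The transposed matrix. -/
def transposeMat {n r : ℕ} (A : Mat n r) : Mat n r :=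
  ⟨A.1.transpose, Finset.sum_comm.trans A.2⟩

theorem ro_transposeMat {n r : ℕ} (A : Mat n r) : ro (transposeMat A) = co A := rfl

theorem co_transposeMat {n r : ℕ} (A : Mat n r) : co (transposeMat A) = ro A := rfl

/-- The transpose of a column block diagonal matrix is a left inverse of it. -/
theorem transposeMat_prod {n r : ℕ} {l : WeakComp n r} {A : Mat n r} (hA : A ∈ cbSet l) :
    prod (transposeMat A) A (co_transposeMat A) = diagMat l := by
  refine eq_diagMat_of_ne_eq_zero (by rw [ro_prod, ro_transposeMat, hA.1])
    (by rw [co_prod, hA.1]) fun j hj => ?_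
  obtain ⟨m, hm, h0, h1⟩ := (cb_iff A).1 hA.2 j hj
  -- The row cut `m` makes both `ne Aᵀ j m` and `ne A m j` vanish, so `m` is a witness that the
  -- minimum defining `ne (Aᵀ A) j j` is zero.
  have h2 := rect_add_ne A.1 hm (Nat.zero_le j)
  rw [ne_full'] at h2
  have h3 : rect A.1 m n 0 j = 0 := by omega
  rw [rect_eq_zero] at h3
  have h4 : ne (transposeMat A).1 j m = 0 := by
    simp only [ne, Finset.sum_eq_zero_iff, Finset.mem_univ, true_implies, ite_eq_right_iff]
    intro a b hab
    exact h3 b a hab.2 b.2 (Nat.zero_le _) hab.1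
  have h5 := ne_prod_le (co_transposeMat A) hj hm hj
  omega

/-! ### Products that fix a matrix -/

/-- The composition `(1, …, 1, 2, 1, …, 1)` whose only nontrivial block is `{p, p + 1}`. -/
def pairComp {n : ℕ} (p : ℕ) (hp : p + 1 < n) : Composition n where
  blocks := List.replicate p 1 ++ 2 :: List.replicate (n - p - 2) 1
  blocks_pos := by
    intro i hi
    simp only [List.mem_append, List.mem_cons, List.mem_replicate] at hi
    omega
  blocks_sum := by
    simp
    omega

theorem pairComp_blocksFun {n : ℕ} {p : ℕ} (hp : p + 1 < n) (v : Fin (pairComp p hp).length) :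
    (pairComp p hp).blocksFun v = if (v : ℕ) = p then 2 else 1 := by
  have key : ∀ (m q : ℕ) (h : q < (List.replicate p 1 ++ 2 :: List.replicate m 1).length),
      (List.replicate p 1 ++ 2 :: List.replicate m 1)[q] = if q = p then 2 else 1 := by
    intro m q h
    simp only [List.getElem_append, List.length_replicate, List.getElem_replicate,
      List.getElem_cons]
    split_ifs <;> omega
  exact key _ v v.2

theorem pairComp_sizeUpTo {n : ℕ} {p : ℕ} (hp : p + 1 < n) : (pairComp p hp).sizeUpTo p = p := by
  simp [Composition.sizeUpTo, pairComp]

theorem pairComp_ne_ones {n : ℕ} {p : ℕ} (hp : p + 1 < n) :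
    pairComp p hp ≠ Composition.ones n := by
  rw [Composition.ne_ones_iff]
  exact ⟨2, by simp [pairComp], one_lt_two⟩

/-- Blocks of length one are always admissible, since their first and last entries coincide; only
the block `{p, p + 1}` imposes a condition. -/
theorem pairComp_isMaximalFor {n r : ℕ} {l : WeakComp n r} {p : ℕ} (hp : p + 1 < n)
    (h0 : l.1 ⟨p, by omega⟩ ≠ 0) (h1 : l.1 ⟨p + 1, hp⟩ ≠ 0) :
    IsMaximalFor (pairComp p hp) l := by
  intro v
  have hv := pairComp_blocksFun hp v
  by_cases h : (v : ℕ) = p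
  · right
    have hs := pairComp_sizeUpTo hp
    have hf : firstPos (pairComp p hp) v = ⟨p, by omega⟩ := by
      refine Fin.ext ?_
      simp only [firstPos, Composition.coe_embedding, h, hs, add_zero]
    have hl : lastPos (pairComp p hp) v = ⟨p + 1, hp⟩ := by
      refine Fin.ext ?_
      simp only [lastPos, Composition.coe_embedding, hv, h, if_true, hs]
    rw [hf, hl]
    exact ⟨h0, h1⟩
  · rw [if_neg h] at hv
    have hfl : lastPos (pairComp p hp) v = firstPos (pairComp p hp) v := by
      refine Fin.ext ?_
      simp only [lastPos, firstPos, Composition.coe_embedding, hv]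
    rw [hfl]
    tauto

/-- Two different columns lie in a common block only if they are the columns `p` and `p + 1`. -/
theorem openOnColumns_pairComp {n : ℕ} {A : Matrix (Fin n) (Fin n) ℕ} {p : ℕ} (hp : p + 1 < n)
    (h : ∀ i i' : Fin n, i < i' → A i ⟨p, by omega⟩ = 0 ∨ A i' ⟨p + 1, hp⟩ = 0) :
    OpenOnColumns (pairComp p hp) A := by
  intro v i i' j j' hi hj
  by_cases hb : (pairComp p hp).index j = v
  · by_cases hb' : (pairComp p hp).index j' = v
    · simp only [colBlock, if_pos hb, if_pos hb']
      rw [eq_comm, ← (pairComp p hp).mem_range_embedding_iff'] at hb hb'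
      obtain ⟨x, rfl⟩ := hb
      obtain ⟨y, rfl⟩ := hb'
      rw [Fin.lt_def, Composition.coe_embedding, Composition.coe_embedding] at hj
      have hv := pairComp_blocksFun hp v
      have hx := x.2
      have hy := y.2
      have hvp : (v : ℕ) = p := by
        by_contra hvp
        rw [if_neg hvp] at hv
        omega
      rw [if_pos hvp] at hv
      have hs := pairComp_sizeUpTo hp
      have e0 : (pairComp p hp).embedding v x = ⟨p, by omega⟩ := by
        refine Fin.ext ?_
        rw [Composition.coe_embedding, hvp, hs]
        simp only
        omega
      have e1 : (pairComp p hp).embedding v y = ⟨p + 1, hp⟩ := by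
        refine Fin.ext ?_
        rw [Composition.coe_embedding, hvp, hs]
        simp only
        omega
      rw [e0, e1]
      exact h i i' hi
    · right; simp only [colBlock, if_neg hb']
  · left; simp only [colBlock, if_neg hb]

/-- If `C` has an entry in the first `j` rows and outside the first `j` columns, and `A C = A`,
then the columns `j - 1` and `j` of `A` form an open matrix. -/
theorem open_of_prod_eq_self {n r : ℕ} {A C : Mat n r} (h : co A = ro C) (hC : ro C = co C)
    (hAC : prod A C h = A) {p : ℕ} (hp : p + 1 < n) (hpos : 0 < ne C.1 (p + 1) (p + 1))
    (i i' : Fin n) (hi : i < i') : A.1 i ⟨p, by omega⟩ = 0 ∨ A.1 i' ⟨p + 1, hp⟩ = 0 := by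
  rw [Fin.lt_def] at hi
  obtain ⟨s, hs, h1⟩ := ne_prod_exists h (i := i + 1) (k := p + 1) i.2 hp.le
  rw [hAC] at h1
  -- Here `s` attains the minimum, which equals `ne A (i + 1) (p + 1)`. If `s < p + 1`, columns `s`
  -- to `p` of `A` have no entry in rows `≤ i`. The case `s = p + 1` contradicts `hpos`.
  rcases lt_trichotomy s (p + 1) with hsp | rfl | hsp
  · left
    have h2 := rect_add_ne A.1 (Nat.zero_le (i + 1)) hsp.le
    rw [ne_zero_left, ne_zero_left] at h2
    have h3 : rect A.1 0 (i + 1) s (p + 1) = 0 := by omega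
    rw [rect_eq_zero] at h3
    exact h3 i ⟨p, by omega⟩ (Nat.zero_le _) (Nat.lt_succ_self _) (Nat.le_of_lt_succ hsp)
      (Nat.lt_succ_self _)
  · omega
  · right
    -- Since `ro C = co C = co A`, `ne C s (p + 1)` is at least the full sum of the columns `p + 1,
    -- …, s - 1` of `A`. Equality at the minimum then leaves no entry of these columns below row
    -- `i`.
    have h2 := rect_add_ne A.1 (show (i : ℕ) + 1 ≤ n from i.2) hsp.le
    have h3 := ne_compl h hs
    have h4 := ne_compl h hp.le
    have h5 := ne_monge C.1 hs (Nat.zero_le (p + 1))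
    have h7 := ne_compl hC.symm hp.le
    rw [ne_full'] at h5
    have h6 : rect A.1 (i + 1) n (p + 1) s = 0 := by omega
    rw [rect_eq_zero] at h6
    exact h6 i' ⟨p + 1, hp⟩ hi i'.2 le_rfl hsp

/-- An element of `B^l` is not fixed by right multiplication by a nondiagonal matrix. -/
theorem prod_ne_self {n r : ℕ} {l : WeakComp n r} (hl : l.IsBullet) {A C : Mat n r}
    (hA : A ∈ BSet l) (hC : co C = l) (hne : C ≠ diagMat l) (h : co A = ro C) :
    prod A C h ≠ A := by
  intro hAC
  have hro : ro C = l := h.symm.trans hA.1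
  obtain ⟨j, hj, hpos⟩ : ∃ j, j ≤ n ∧ 0 < ne C.1 j j := by
    by_contra hcon
    push Not at hcon
    exact hne (eq_diagMat_of_ne_eq_zero hro hC fun j hj => Nat.le_zero.1 (hcon j hj))
  -- The corner sums at `j = 0` and `j = n` are zero, so `j = p + 1` and the columns `p`, `p + 1`
  -- both exist.
  obtain _ | p := j
  · rw [ne_zero_left] at hpos
    omega
  have hp : p + 1 < n := by
    refine lt_of_le_of_ne hj fun hpn => ?_
    rw [hpn, ne_last] at hpos
    omega
  obtain ⟨a, b, hb, hab⟩ : ∃ a b : Fin n, p + 1 ≤ (b : ℕ) ∧ C.1 a b ≠ 0 := by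
    by_contra hcon
    push Not at hcon
    refine hpos.ne' ?_
    simp only [ne, Finset.sum_eq_zero_iff, Finset.mem_univ, true_implies, ite_eq_right_iff]
    exact fun a b hab => hcon a b hab.2
  have hlb : l.1 b ≠ 0 := by
    rw [← hC]
    intro h0
    change ∑ i, C.1 i b = 0 at h0
    exact hab (Finset.sum_eq_zero_iff.1 h0 a (Finset.mem_univ a))
  -- A zero of `l` before `b` would propagate to `b`; so `l` is nonzero at `p` and `p + 1`, both of
  -- which are at most `b`.
  have hl0 : ∀ q : Fin n, q ≤ b → l.1 q ≠ 0 := by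
    intro q hq h0
    rcases hq.lt_or_eq with hq | rfl
    · exact hlb (hl q h0 b hq)
    · exact hlb h0
  refine hA.2 (pairComp p hp) (pairComp_isMaximalFor hp (hl0 _ ?_) (hl0 _ hb))
    (pairComp_ne_ones hp)
    (openOnColumns_pairComp hp (open_of_prod_eq_self h (hro.trans hC.symm) hAC hp hpos))
  exact Fin.le_def.2 ((Nat.le_succ p).trans hb)

/-! ### Growth of corner sums under right multiplication -/

/-- Right multiplication by a matrix with equal row and column sums increases the corner sums. -/
theorem ne_le_ne_prod {n r : ℕ} {A C : Mat n r} (h : co A = ro C) (hC : ro C = co C) {i k : ℕ}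
    (hi : i ≤ n) (hk : k ≤ n) : ne A.1 i k ≤ ne (prod A C h).1 i k := by
  obtain ⟨s, hs, h1⟩ := ne_prod_exists h hi hk
  rcases le_total s k with hsk | hsk
  · have h2 := ne_monge A.1 (Nat.zero_le i) hsk
    rw [ne_zero_left, ne_zero_left] at h2
    omega
  · have h2 := ne_monge A.1 hi hsk
    have h3 := ne_compl h hs
    have h4 := ne_compl h hk
    have h5 := ne_monge C.1 hs (Nat.zero_le k)
    have h6 := ne_compl hC.symm hk
    rw [ne_full'] at h5
    omega

/-- The sum of all corner sums. -/
def cornerSum {n r : ℕ} (A : Mat n r) : ℕ :=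
  ∑ i ∈ Finset.range (n + 1), ∑ k ∈ Finset.range (n + 1), ne A.1 i k

/-- Each corner sum is at most `r`. The bound turns the growth of `cornerSum` into a terminating
induction. -/
theorem cornerSum_le {n r : ℕ} (A : Mat n r) : cornerSum A ≤ (n + 1) * ((n + 1) * r) := by
  have h : ∀ i ∈ Finset.range (n + 1), ∀ k ∈ Finset.range (n + 1), ne A.1 i k ≤ r := by
    intro i hi k _
    rw [Finset.mem_range] at hi
    have h1 := ne_monge A.1 (Nat.zero_le i) (Nat.zero_le k)
    have h2 := ne_monge A.1 (Nat.le_of_lt_succ hi) (Nat.zero_le n)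
    rw [ne_zero_left, ne_zero_left] at h1
    rw [ne_last, ne_last, ne_full'] at h2
    omega
  refine (Finset.sum_le_sum fun i hi => Finset.sum_le_sum (h i hi)).trans ?_
  simp

/-- No corner sum decreases, and a matrix is determined by its corner sums; so equal totals would
force the two matrices to agree. -/
theorem cornerSum_lt {n r : ℕ} {A C : Mat n r} (h : co A = ro C) (hC : ro C = co C)
    (hne : prod A C h ≠ A) : cornerSum A < cornerSum (prod A C h) := by
  have hle : ∀ i ∈ Finset.range (n + 1), ∀ k ∈ Finset.range (n + 1),
      ne A.1 i k ≤ ne (prod A C h).1 i k := fun i hi k hk =>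
    ne_le_ne_prod h hC (Nat.le_of_lt_succ (Finset.mem_range.1 hi))
      (Nat.le_of_lt_succ (Finset.mem_range.1 hk))
  refine lt_of_le_of_ne (Finset.sum_le_sum fun i hi => Finset.sum_le_sum (hle i hi)) fun heq => ?_
  rw [cornerSum, cornerSum,
    Finset.sum_eq_sum_iff_of_le fun i hi => Finset.sum_le_sum (hle i hi)] at heq
  refine hne (Subtype.ext (ne_inj fun i k hi hk => ?_))
  have h1 := heq i (Finset.mem_range.2 (Nat.lt_succ_of_le hi))
  rw [Finset.sum_eq_sum_iff_of_le (hle i (Finset.mem_range.2 (Nat.lt_succ_of_le hi)))] at h1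
  exact (h1 k (Finset.mem_range.2 (Nat.lt_succ_of_le hk))).symm

/-! ### The radical of `P_l` -/

noncomputable section

/-- The generator `k_l` of `P_l`. -/
def genP {n r : ℕ} (l : WeakComp n r) : P l := eP ⟨diagMat l, diagMat_mem_BSet l⟩

theorem e_smul_genP {n r : ℕ} {l : WeakComp n r} (A : BSet l) : e A.1 • genP l = eP A := by
  have h : co A.1 = ro (diagMat l) := by rw [ro_diag, A.2.1]
  rw [genP, smul_def, incl_eP, e_mul_e, dif_pos h, prod_diag_right h, proj_e_mem A.2]

theorem eq_top_of_genP_mem {n r : ℕ} {l : WeakComp n r} {M : Submodule (Alg n r) (P l)}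
    (h : genP l ∈ M) : M = ⊤ := by
  refine eq_top_iff.2 fun x _ => ?_
  refine P_induction (p := fun x => x ∈ M) x M.zero_mem (fun _ _ => M.add_mem) fun c A => ?_
  rw [← e_smul_genP A]
  exact M.smul_of_tower_mem c (M.smul_mem _ h)

/-! ### Coefficients and membership in `N_l` -/

/-- The coefficient of a basis element. -/
def coeffP {n r : ℕ} {l : WeakComp n r} (A : BSet l) : P l →ₗ[ℂ] ℂ :=
  (Finsupp.lapply A : (BSet l →₀ ℂ) →ₗ[ℂ] ℂ)

theorem coeffP_eP_self {n r : ℕ} {l : WeakComp n r} (A : BSet l) : coeffP A (eP A) = 1 :=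
  Finsupp.single_eq_same

theorem coeffP_eP_of_ne {n r : ℕ} {l : WeakComp n r} {A B : BSet l} (h : A ≠ B) :
    coeffP A (eP B) = 0 :=
  Finsupp.single_eq_of_ne h

theorem eP_mem_N {n r : ℕ} {l : WeakComp n r} {A : BSet l} (hA : A.1 ∉ cbSet l) : eP A ∈ N l :=
  Submodule.subset_span (R := ℂ) (s := {x : P l | ∃ A : BSet l, A.1 ∉ cbSet l ∧ x = eP A})
    ⟨A, hA, rfl⟩

theorem N_induction {n r : ℕ} {l : WeakComp n r} {p : P l → Prop} {x : P l} (hx : x ∈ N l)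
    (h0 : p 0) (hadd : ∀ x y, p x → p y → p (x + y)) (hs : ∀ (c : ℂ) x, p x → p (c • x))
    (hA : ∀ A : BSet l, A.1 ∉ cbSet l → p (eP A)) : p x := by
  change x ∈ Submodule.span ℂ {x : P l | ∃ A : BSet l, A.1 ∉ cbSet l ∧ x = eP A} at hx
  induction hx using Submodule.span_induction with
  | zero => exact h0
  | add x y _ _ hx hy => exact hadd x y hx hy
  | smul c x _ hx => exact hs c x hx
  | mem x hx =>
    obtain ⟨A, h, rfl⟩ := hx
    exact hA A h

/-- `N_l` is a coordinate subspace; an element outside it thus has a nonzero coefficient at some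
column block diagonal matrix. -/
theorem mem_N_iff {n r : ℕ} {l : WeakComp n r} {x : P l} :
    x ∈ N l ↔ ∀ A : BSet l, A.1 ∈ cbSet l → coeffP A x = 0 := by
  constructor
  · intro hx A hA
    refine N_induction (p := fun x => coeffP A x = 0) hx (map_zero _) ?_ ?_ ?_
    · intro x y hx hy; rw [map_add, hx, hy, add_zero]
    · intro c x hx; rw [map_smul, hx, smul_zero]
    · intro B hB
      exact coeffP_eP_of_ne (by rintro rfl; exact hB hA)
  · intro h
    have hsum : x = ∑ A ∈ Finsupp.support x, coeffP A x • eP A := by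
      refine (Finsupp.sum_single x).symm.trans (Finset.sum_congr rfl fun A _ => ?_)
      exact (Finsupp.smul_single_one A _).symm
    rw [hsum]
    refine Submodule.sum_mem _ fun A _ => ?_
    by_cases hA : A.1 ∈ cbSet l
    · rw [h A hA, zero_smul]
      exact Submodule.zero_mem _
    · exact (N l).smul_of_tower_mem _ (eP_mem_N hA)

theorem genP_notMem_N {n r : ℕ} (l : WeakComp n r) : genP l ∉ N l := by
  intro h
  have h1 := mem_N_iff.1 h ⟨diagMat l, diagMat_mem_BSet l⟩ (diagMat_mem_cbSet l)
  rw [genP, coeffP_eP_self] at h1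
  exact one_ne_zero h1

/-- On basis elements: `e_{Aᵀ}` sends `e_A` to `k_l`, kills the other elements of `β^l` because
their row sums differ from `ro A`, and preserves `N_l`, which contains the remaining ones. -/
theorem transpose_smul_sub_mem_N {n r : ℕ} {l : WeakComp n r} (A : BSet l) (hA : A.1 ∈ cbSet l)
    (x : P l) : e (transposeMat A.1) • x - coeffP A x • genP l ∈ N l := by
  refine P_induction (p := fun x => e (transposeMat A.1) • x - coeffP A x • genP l ∈ N l) x ?_ ?_ ?_
  · rw [smul_zero, map_zero, zero_smul, sub_zero]
    exact Submodule.zero_mem _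
  · intro x y hx hy
    rw [smul_add, map_add, add_smul, add_sub_add_comm]
    exact Submodule.add_mem _ hx hy
  · intro c B
    have hcomm : e (transposeMat A.1) • c • eP B = c • e (transposeMat A.1) • eP B := by
      rw [smul_def, smul_def, map_smul, mul_smul_comm, map_smul]
    rw [hcomm, map_smul, smul_assoc, ← smul_sub]
    refine (N l).smul_of_tower_mem c ?_
    by_cases hAB : A = B
    · subst hAB
      rw [coeffP_eP_self, one_smul, smul_def, incl_eP, e_mul_e, dif_pos (co_transposeMat A.1),
        transposeMat_prod hA, proj_e_mem (diagMat_mem_BSet l), genP, sub_self]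
      exact Submodule.zero_mem _
    · rw [coeffP_eP_of_ne hAB, zero_smul, sub_zero]
      by_cases hB : B.1 ∈ cbSet l
      · have h : ¬ co (transposeMat A.1) = ro B.1 := fun h =>
          hAB (Subtype.ext (cbSet_ext hA hB h))
        rw [smul_def, incl_eP, e_mul_e, dif_neg h, map_zero]
        exact Submodule.zero_mem _
      · exact Submodule.smul_mem _ _ (eP_mem_N hB)

/-- `S_l` is simple. -/
theorem isCoatom_N {n r : ℕ} (l : WeakComp n r) : IsCoatom (N l) := by
  refine ⟨fun h => genP_notMem_N l (h ▸ Submodule.mem_top), fun M hM => ?_⟩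
  obtain ⟨x, hx, hxN⟩ := SetLike.exists_of_lt hM
  rw [mem_N_iff] at hxN
  push Not at hxN
  obtain ⟨A, hA, hc⟩ := hxN
  refine eq_top_of_genP_mem ?_
  -- Subtracting the error term in `N l ≤ M` leaves a nonzero multiple of the generator in `M`.
  have h1 := M.sub_mem (M.smul_mem (e (transposeMat A.1)) hx)
    (hM.le (transpose_smul_sub_mem_N A hA x))
  rw [sub_sub_cancel] at h1
  have h2 := M.smul_of_tower_mem (coeffP A x)⁻¹ h1
  rwa [smul_smul, inv_mul_cancel₀ hc, one_smul] at h2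

/-- Modulo `M`, `e_A` equals `e_A y`, whose terms have strictly larger `cornerSum`; repeating the
replacement must end, since `cornerSum` is bounded. -/
theorem eP_mem_of_genP_sub_mem {n r : ℕ} {l : WeakComp n r} (hl : l.IsBullet)
    {M : Submodule (Alg n r) (P l)} {y : P l} (hy : y ∈ N l) (hM : genP l - y ∈ M) (A : BSet l) :
    eP A ∈ M := by
  -- The induction runs on the distance of `cornerSum A` from its upper bound.
  induction hd : (n + 1) * ((n + 1) * r) - cornerSum A.1 using Nat.strong_induction_on
    generalizing A with
  | _ d ih =>
    have h1 := M.smul_mem (e A.1) hM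
    rw [smul_sub, e_smul_genP] at h1
    suffices h2 : e A.1 • y ∈ M by
      have h3 := M.add_mem h1 h2
      rwa [sub_add_cancel] at h3
    refine N_induction (p := fun y => e A.1 • y ∈ M) hy ?_ ?_ ?_ ?_
    · rw [smul_zero]; exact M.zero_mem
    · intro x y hx hy; rw [smul_add]; exact M.add_mem hx hy
    · intro c x hx
      have hcomm : e A.1 • c • x = c • e A.1 • x := by
        rw [smul_def, smul_def, map_smul, mul_smul_comm, map_smul]
      rw [hcomm]
      exact M.smul_of_tower_mem c hx
    · intro C hC
      rw [e_smul_eP]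
      split_ifs with h
      -- A nonzero product forces `ro C = co A = l = co C`, and `C` is not diagonal because `diagMat
      -- l` lies in `cbSet l`.
      · have hlt := cornerSum_lt h.1 (h.1.symm.trans (A.2.1.trans C.2.1.symm))
          (prod_ne_self hl A.2 C.2.1 (fun hd => hC (hd ▸ diagMat_mem_cbSet l)) h.1)
        refine ih _ ?_ ⟨_, h.2⟩ rfl
        have h3 := cornerSum_le (SchurZero.prod A.1 C.1 h.1)
        simp only
        omega
      · exact M.zero_mem

/-- `N_l` is superfluous in `P_l`. -/
theorem eq_top_of_sup_N_eq_top {n r : ℕ} {l : WeakComp n r} (hl : l.IsBullet)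
    {M : Submodule (Alg n r) (P l)} (h : M ⊔ N l = ⊤) : M = ⊤ := by
  obtain ⟨x, hx, y, hy, hxy⟩ := Submodule.mem_sup.1 (h ▸ Submodule.mem_top : genP l ∈ M ⊔ N l)
  refine eq_top_of_genP_mem (eP_mem_of_genP_sub_mem hl hy ?_ _)
  rwa [← hxy, add_sub_cancel_right]

theorem N_eq_jacobson {n r : ℕ} {l : WeakComp n r} (hl : l.IsBullet) :
    N l = Module.jacobson (Alg n r) (P l) := by
  refine le_antisymm (le_sInf fun M hM => ?_) (sInf_le (isCoatom_N l))
  by_contra hN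
  -- A maximal `M` not containing `N l` has `M ⊔ N l = ⊤`, hence `M = ⊤` by superfluity, a
  -- contradiction.
  exact hM.1 (eq_top_of_sup_N_eq_top hl (hM.2 _ (left_lt_sup.2 hN)))

end

end SchurZero

theorem mainTheorem2 (n r : ℕ) (l : SchurZero.WeakComp n r) (hl : l.IsBullet) :
    SchurZero.N l = Module.jacobson (SchurZero.Alg n r) (SchurZero.P l) ∧
      ∃ φ : SchurZero.S l ≃ₗ[SchurZero.Alg n r]
          SchurZero.top (SchurZero.Alg n r) (SchurZero.P l),
        ∀ x : SchurZero.P l, φ (Submodule.Quotient.mk x) = Submodule.Quotient.mk x :=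
  ⟨SchurZero.N_eq_jacobson hl,
    Submodule.quotEquivOfEq _ _ (SchurZero.N_eq_jacobson hl),
    fun x => Submodule.quotEquivOfEq_mk _ _ (SchurZero.N_eq_jacobson hl) x⟩
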